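/- Let $G$ be a connected, locally compact, second countable, Hausdorff topological group, and let $P\subset G$ be a Borel subset that is a subsemigroup, has non-empty interior $\mathrm{Int}(P)$ in $G$, and is normal in $G$, i.e. $gPg^{-1}=P$ for every $g\in G$. Then: (1) every $a\in \mathrm{Int}(P)$ is an order unit of $P$, i.e. for every $x\in P$ there are an integer $n\ge 1$ and $b\in P$ with $a^n=xb$; (2) every product system over $P$ is concrete. Here a product system over $P$ is a field $E=\{E(x)\}_{x\in P}$ of non-zero separable complex Hilbert spaces, together with an associative product on $\coprod_{x\in P}E(x)$ and a set $\Gamma$ of sections, such that: (i) for $x,y\in P$, the product maps $E(x)\times E(y)$ into $E(xy)$, and there is a unitary operator from the Hilbert space tensor product $E(x)\otimes E(y)$ onto $E(xy)$ with $u\otimes v\mapsto uv$; (ii) $E$ is a measurable field of Hilbert spaces with $\Gamma$ as its space of measurable sections: $x\mapsto\langle r(x)|s(x)\rangle$ is Borel measurable for $r,s\in\Gamma$; every section $s$ such that $x\mapsto \langle r(x)|s(x)\rangle$ is measurable for all $r\in\Gamma$ belongs to $\Gamma$; and there is a sequence $(e_n)$ in $\Gamma$ such that $\{e_n(x)\}_n$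 spans a dense subspace of $E(x)$ for every $x\in P$; (iii) for $r,s,t\in\Gamma$, the map $P\times P\ni(x,y)\mapsto\langle r(x)s(y)|t(xy)\rangle$ is measurable. An $E_0$-semigroup over $P$ on $B(H)$, where $H$ is a separable Hilbert space, is a family $\alpha=\{\alpha_x\}_{x\in P}$ of unital normal (i.e. ultraweakly continuous) $*$-endomorphisms of $B(H)$ with $\alpha_{xy}=\alpha_x\circ\alpha_y$ such that $x\mapsto\langle\alpha_x(A)\xi|\eta\rangle$ is measurable for all $A\in B(H)$ and $\xi,\eta\in H$. Its product system has fibres $E_\alpha(x)=\{T\in B(H):\alpha_x(A)T=TA \text{ for all } A\in B(H)\}$ with inner product given by $\langle S|T\rangle 1=T^*S$, composition of operators as product, and the weakly measurable maps $f:P\to B(H)$ with $f(x)\in E_\alpha(x)$ as measurable sections. A product system $E$ over $P$ is concrete if, for some $E_0$-semigroup $\alpha$ over $P$, there are unitary operators $\theta_x:E(x)\to E_\alpha(x)$, $x\in P$, with $\theta_{xy}(uv)=\theta_x(u)\theta_y(v)$ for $u\in E(x)$, $v\in E(y)$, such that $x\mapsto\theta_x(s(x))$ is a measurable section for every measurable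 section $s$ of $E$. -/

import Mathlib

open MeasureTheory
open scoped TensorProduct InnerProductSpace

universe u v w

/-! ### Subsemigroups of a group: normality, the right order, order units -/

/-- `P` is normal in `G`: `g P g⁻¹ = P` for every `g ∈ G`. -/
def Subsemigroup.IsNormalIn {G : Type v} [Group G] (P : Subsemigroup G) : Prop :=
  ∀ g : G, (fun x : G => g * x * g⁻¹) '' (P : Set G) = (P : Set G)

/-- `x ≤ y` with respect to `P`: `y = x b` for some `b ∈ P`. -/
def Subsemigroup.RightLE {G : Type v} [Group G] (P : Subsemigroup G) (x y : G) : Prop :=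
  ∃ b ∈ P, y = x * b

/-- `a ∈ P` is an order unit of `P`: every `x ∈ P` satisfies `x ≤ a ^ n` for some `n ≥ 1`. -/
def Subsemigroup.IsOrderUnit {G : Type v} [Group G] (P : Subsemigroup G) (a : G) : Prop :=
  a ∈ P ∧ ∀ x ∈ P, ∃ n : ℕ, 1 ≤ n ∧ P.RightLE x (a ^ n)

/-! ### Product systems -/

/-- The data of a product system over `P`: a field of Hilbert spaces, a product
`E(x) × E(y) → E(xy)`, and a set of sections. The axioms are in `IsProductSystem`. -/
structure ProductSystemData (P : Type v) [Mul P] where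
  /-- the Hilbert space `E(x)` -/
  fiber : P → Type u
  [instNormedAddCommGroup : ∀ x, NormedAddCommGroup (fiber x)]
  [instInnerProductSpace : ∀ x, InnerProductSpace ℂ (fiber x)]
  [instCompleteSpace : ∀ x, CompleteSpace (fiber x)]
  /-- the product -/
  mul : ∀ {x y : P}, fiber x → fiber y → fiber (x * y)
  /-- the sections that are declared measurable -/
  sections : Set (∀ x, fiber x)

namespace ProductSystemData

attribute [instance] instNormedAddCommGroup instInnerProductSpace instCompleteSpace

variable {P : Type v} [Mul P]

/-- An algebraic product system: the fibres are non-zero and separable, the product on the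
disjoint union of the fibres is associative, and `u ⊗ v ↦ u v` extends to a unitary operator from
the Hilbert space tensor product `E(x) ⊗ E(y)` (the completion of the algebraic tensor
product) onto `E(xy)`. -/
structure IsAlgebraic (E : ProductSystemData.{u} P) : Prop where
  nontrivial : ∀ x, Nontrivial (E.fiber x)
  separable : ∀ x, TopologicalSpace.SeparableSpace (E.fiber x)
  assoc : ∀ {x y z : P} (a : E.fiber x) (b : E.fiber y) (c : E.fiber z),
    (⟨x * y * z, E.mul (E.mul a b) c⟩ : Σ t, E.fiber t) = ⟨x * (y * z), E.mul a (E.mul b c)⟩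
  exists_unitary : ∀ x y : P,
    ∃ U : UniformSpace.Completion (E.fiber x ⊗[ℂ] E.fiber y) ≃ₗᵢ[ℂ] E.fiber (x * y),
      ∀ (a : E.fiber x) (b : E.fiber y),
        U ((a ⊗ₜ[ℂ] b : E.fiber x ⊗[ℂ] E.fiber y) :
          UniformSpace.Completion (E.fiber x ⊗[ℂ] E.fiber y)) = E.mul a b

/-- The fibres form a measurable field of Hilbert spaces with `E.sections` as the space of
measurable sections: inner products of measurable sections are measurable, every section whose
inner products with all measurable sections are measurable is itself measurable (so that the
measurable sections form a vector space), and there is a sequence of measurable sections whose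
values at `x` span a dense subspace of `E(x)`, for every `x`. -/
structure IsMeasurableField [MeasurableSpace P] (E : ProductSystemData.{u} P) : Prop where
  measurable_inner : ∀ r ∈ E.sections, ∀ s ∈ E.sections,
    Measurable fun x => ⟪r x, s x⟫_ℂ
  mem_of_measurable_inner : ∀ s : (∀ x, E.fiber x),
    (∀ r ∈ E.sections, Measurable fun x => ⟪r x, s x⟫_ℂ) → s ∈ E.sections
  exists_total : ∃ e : ℕ → ∀ x, E.fiber x, (∀ n, e n ∈ E.sections) ∧
    ∀ x, Dense (Submodule.span ℂ (Set.range fun n => e n x) : Set (E.fiber x))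

/-- A product system over `P`. -/
structure IsProductSystem [MeasurableSpace P] (E : ProductSystemData.{u} P) : Prop where
  isAlgebraic : E.IsAlgebraic
  isMeasurableField : E.IsMeasurableField
  measurable_mul : ∀ r ∈ E.sections, ∀ s ∈ E.sections, ∀ t ∈ E.sections,
    Measurable fun p : P × P => ⟪t (p.1 * p.2), E.mul (r p.1) (s p.2)⟫_ℂ

/-- Isomorphism of product systems: a family of unitaries `θ x : E(x) → F(x)` that is
multiplicative and is a measurable field of operators, that is, carries measurable sections to
measurable sections. -/
def Isomorphic (E : ProductSystemData.{u} P) (F : ProductSystemData.{w} P) : Prop :=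
  ∃ θ : ∀ x, E.fiber x ≃ₗᵢ[ℂ] F.fiber x,
    (∀ (x y : P) (a : E.fiber x) (b : E.fiber y),
      θ (x * y) (E.mul a b) = F.mul (θ x a) (θ y b)) ∧
    ∀ s ∈ E.sections, (fun x => θ x (s x)) ∈ F.sections

end ProductSystemData

/-! ### `E₀`-semigroups -/

section Ultraweak

variable (H : Type w) [NormedAddCommGroup H] [InnerProductSpace ℂ H]

/-- Square-summable sequences of vectors. -/
def SquareSummableSeq : Type w := {ξ : ℕ → H // Summable fun n => ‖ξ n‖ ^ 2}

/-- The ultraweak (σ-weak) topology on `B(H)`: the coarsest topology that makes the functionals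
`A ↦ ∑ₙ ⟨A ξₙ | ηₙ⟩` continuous, for all square-summable sequences `ξ`, `η` in `H`. -/
@[reducible] noncomputable def ultraweakTopology : TopologicalSpace (H →L[ℂ] H) :=
  TopologicalSpace.induced
    (fun (A : H →L[ℂ] H) (p : SquareSummableSeq H × SquareSummableSeq H) =>
      ∑' n, ⟪p.2.1 n, A (p.1.1 n)⟫_ℂ)
    inferInstance

/-- A map `B(H) → B(H)` is normal if it is continuous for the ultraweak topology. -/
def IsNormalMap (f : (H →L[ℂ] H) → (H →L[ℂ] H)) : Prop :=
  @Continuous _ _ (ultraweakTopology H) (ultraweakTopology H) f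

end Ultraweak

/-- An `E₀`-semigroup over `P` acting on `B(H)`: a semigroup of unital normal `*`-endomorphisms of
`B(H)` such that `x ↦ α_x(A)` is weakly measurable for every `A ∈ B(H)`. -/
structure E0Semigroup (P : Type v) [Mul P] [MeasurableSpace P]
    (H : Type w) [NormedAddCommGroup H] [InnerProductSpace ℂ H] [CompleteSpace H] where
  /-- the unital `*`-endomorphism `α_x` -/
  map : P → ((H →L[ℂ] H) →⋆ₐ[ℂ] (H →L[ℂ] H))
  normal : ∀ x, IsNormalMap H (map x)
  map_mul : ∀ x y A, map (x * y) A = map x (map y A)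
  measurable : ∀ (A : H →L[ℂ] H) (ξ η : H), Measurable fun x => ⟪η, map x A ξ⟫_ℂ

namespace E0Semigroup

variable {P : Type v} [Mul P] [MeasurableSpace P]
  {H : Type w} [NormedAddCommGroup H] [InnerProductSpace ℂ H] [CompleteSpace H]

/-- The intertwining space `{T ∈ B(H) : α_x(A) T = T A for all A ∈ B(H)}`. -/
def intertwiner (α : E0Semigroup P H) (x : P) : Submodule ℂ (H →L[ℂ] H) where
  carrier := {T | ∀ A : H →L[ℂ] H, α.map x A * T = T * A}
  zero_mem' := fun A => by simp
  add_mem' := fun {S T} hS hT A => by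
    rw [mul_add, add_mul, hS A, hT A]
  smul_mem' := fun c T hT A => by
    rw [mul_smul_comm, smul_mul_assoc, hT A]

lemma intertwiner_isClosed (α : E0Semigroup P H) (x : P) :
    IsClosed (α.intertwiner x : Set (H →L[ℂ] H)) := by
  have h : (α.intertwiner x : Set (H →L[ℂ] H)) =
      ⋂ A : H →L[ℂ] H, {T | α.map x A * T = T * A} := by
    ext T
    simp [intertwiner]
  rw [h]
  exact isClosed_iInter fun A =>
    isClosed_eq (continuous_const.mul continuous_id) (continuous_id.mul continuous_const)

instance intertwinerCompleteSpace (α : E0Semigroup P H) (x : P) : CompleteSpace (α.intertwiner x) :=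
  (α.intertwiner_isClosed x).completeSpace_coe

/-- For `S, T` in the intertwining space, `S* T` is a scalar operator. -/
lemma exists_scalar (α : E0Semigroup P H) (x : P) (S T : α.intertwiner x) :
    ∃ c : ℂ, star (S : H →L[ℂ] H) * (T : H →L[ℂ] H) = c • 1 := by
  have h : star (S : H →L[ℂ] H) * (T : H →L[ℂ] H) ∈ Subalgebra.center ℂ (H →L[ℂ] H) := by
    rw [Subalgebra.mem_center_iff]
    intro A
    have h1 : A * star (S : H →L[ℂ] H) = star (S : H →L[ℂ] H) * α.map x A := by
      have h2 := congrArg star (S.2 (star A))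
      rw [star_mul, star_mul, star_star, map_star, star_star] at h2
      exact h2.symm
    rw [← mul_assoc, h1, mul_assoc, T.2 A, mul_assoc]
  obtain ⟨c, hc⟩ := (Algebra.IsCentral.mem_center_iff ℂ).1 h
  exact ⟨c, by rw [hc, Algebra.algebraMap_eq_smul_one]⟩

/-- The scalar `c` with `S* T = c 1`. -/
noncomputable def scalar (α : E0Semigroup P H) (x : P) (S T : α.intertwiner x) : ℂ :=
  (α.exists_scalar x S T).choose

lemma scalar_spec (α : E0Semigroup P H) (x : P) (S T : α.intertwiner x) :
    star (S : H →L[ℂ] H) * (T : H →L[ℂ] H) = α.scalar x S T • 1 :=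
  (α.exists_scalar x S T).choose_spec

lemma mul_mem_intertwiner (α : E0Semigroup P H) {x y : P} {S T : H →L[ℂ] H}
    (hS : S ∈ α.intertwiner x) (hT : T ∈ α.intertwiner y) :
    S * T ∈ α.intertwiner (x * y) := fun A => by
  rw [α.map_mul, ← mul_assoc, hS, mul_assoc, hT A, mul_assoc]

variable [Nontrivial H]

lemma scalar_eq (α : E0Semigroup P H) (x : P) (S T : α.intertwiner x) {c : ℂ}
    (h : star (S : H →L[ℂ] H) * (T : H →L[ℂ] H) = c • 1) : α.scalar x S T = c :=
  smul_left_injective ℂ (one_ne_zero : (1 : H →L[ℂ] H) ≠ 0)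
    ((α.scalar_spec x S T).symm.trans h)

/-- The Hilbert space structure on the intertwining space: the inner product of `S` and `T`
(conjugate-linear in `S`) is the scalar `S* T`, and the norm is the operator norm. -/
noncomputable instance intertwinerInnerProductSpace (α : E0Semigroup P H) (x : P) :
    InnerProductSpace ℂ (α.intertwiner x) where
  inner S T := α.scalar x S T
  norm_sq_eq_re_inner S := by
    have h := α.scalar_spec x S S
    have hn : ‖(S : H →L[ℂ] H)‖ * ‖(S : H →L[ℂ] H)‖ = ‖α.scalar x S S‖ := by
      rw [← CStarRing.norm_star_mul_self, h, norm_smul, norm_one, mul_one]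
    obtain ⟨ξ, hξ⟩ := exists_ne (0 : H)
    have hs : α.scalar x S S * ((‖ξ‖ : ℂ) ^ 2) = ((‖(S : H →L[ℂ] H) ξ‖ : ℂ) ^ 2) := by
      have h1 := congrArg (fun A : H →L[ℂ] H => ⟪ξ, A ξ⟫_ℂ) h
      simp only [mul_apply_eq_comp, ContinuousLinearMap.star_eq_adjoint,
        ContinuousLinearMap.adjoint_inner_right, _root_.smul_apply,
        one_apply_eq_self, inner_smul_right, inner_self_eq_norm_sq_to_K] at h1
      exact h1.symm
    have hr : α.scalar x S S = ((‖(S : H →L[ℂ] H) ξ‖ ^ 2 / ‖ξ‖ ^ 2 : ℝ) : ℂ) := by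
      have hξ' : (‖ξ‖ : ℂ) ≠ 0 := by exact_mod_cast norm_ne_zero_iff.2 hξ
      push_cast
      rw [eq_div_iff (pow_ne_zero 2 hξ')]
      exact hs
    have hpos : (0 : ℝ) ≤ ‖(S : H →L[ℂ] H) ξ‖ ^ 2 / ‖ξ‖ ^ 2 := by positivity
    change ‖(S : H →L[ℂ] H)‖ ^ 2 = (α.scalar x S S).re
    rw [sq, hn, hr, Complex.norm_real, Complex.ofReal_re, Real.norm_of_nonneg hpos]
  conj_inner_symm S T := by
    refine (α.scalar_eq x S T ?_).symm
    have h := congrArg star (α.scalar_spec x T S)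
    rw [star_mul, star_star, star_smul, star_one] at h
    exact h
  add_left S T R := by
    refine α.scalar_eq x (S + T) R ?_
    rw [Submodule.coe_add, star_add, add_mul, α.scalar_spec x S R, α.scalar_spec x T R, add_smul]
  smul_left S T c := by
    refine α.scalar_eq x (c • S) T ?_
    rw [Submodule.coe_smul, star_smul, smul_mul_assoc, α.scalar_spec x S T, smul_smul]
    rfl

/-- The product system associated with an `E₀`-semigroup: the fibres are the intertwining spaces,
the product is composition of operators, and the measurable sections are the weakly measurable
ones. -/
noncomputable def productSystem (α : E0Semigroup P H) : ProductSystemData.{w} P where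
  fiber x := α.intertwiner x
  mul S T := ⟨(S : H →L[ℂ] H) * (T : H →L[ℂ] H), α.mul_mem_intertwiner S.2 T.2⟩
  sections := {f | ∀ ξ η : H, Measurable fun x => ⟪η, (f x : H →L[ℂ] H) ξ⟫_ℂ}

end E0Semigroup

/-- A product system is concrete if it is isomorphic to the product system associated with an
`E₀`-semigroup over `P` on `B(H)` for some separable Hilbert space `H`. The space `H` is non-zero
since the fibres of a product system are non-zero, and it can be taken in the lowest universe since
every separable Hilbert space is isomorphic to one there. -/
def ProductSystemData.IsConcrete {P : Type v} [Mul P] [MeasurableSpace P]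
    (E : ProductSystemData.{u} P) : Prop :=
  ∃ (H : Type) (_ : NormedAddCommGroup H) (_ : InnerProductSpace ℂ H) (_ : CompleteSpace H)
    (_ : Nontrivial H) (_ : TopologicalSpace.SeparableSpace H) (α : E0Semigroup P H),
    E.Isomorphic α.productSystem

/-!
The order-unit statement is a connectedness argument. For `a` in the interior of `P`, normality makes
the set of all `x` with `x aⁿ ∈ P` for some `n ≥ 1` a semigroup, and it is a neighbourhood of `1`.
Hence the `x` for which both `x` and `x⁻¹` have this property form an open subgroup, which is all of
`G` (`Subsemigroup.IsNormalIn.exists_mul_pow_mem`).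

A product system is concrete as soon as it has an essential representation on a non-zero separable
Hilbert space `H`, that is, a measurable multiplicative family of unitaries `E(x) ⊗ H ≅ H`: the
endomorphisms `α_x(A) = 1 ⊗ A` form an `E₀`-semigroup whose intertwining spaces are the `E(x)`
(`EssentialRep.isConcrete`). A Gram–Schmidt field of bases of the `E(x)` gives the series that prove
measurability, and the same expansion at a single point shows that `α_x` is normal.

To find such a representation, let `E` act on the square-integrable sections over `P`, for left Haar
measure, by `(φ(v) f)(s x) = v f(x)` (`leftRegular`). This is isometric but not essential, as `φ(v) f`
is supported on `s P`. Fix a unit vector `e ∈ E(a)`. The right shift `(R f)(x a) = √c f(x) e`, where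
`c` is the factor by which right translation by `a` changes Haar measure, is an isometry that commutes
with all `φ(v)`. So `φ` extends to the inductive limit along `R`, realised as the completion of the
space of sequences with `ξ (n + 1) = R (ξ n)` for large `n` (`StableSeq`). For given `s`, every point
of `P` is moved into `s P` by a power of `a`, so `Rᵏ f` is almost supported on `s P` for large `k`
(`exists_rightShift_pow_near`). Sections supported on `s P` lie in the closed span of the `φ(v) f`
with `v ∈ E(s)`, because products are total in `E(s x)` (`exists_mem_range_leftRegular`). Hence the
extension is essential. No quotient of `G` by the powers of `a` and no invariant measure on it are
needed.
-/

/-! ### Orthonormal bases padded with zero vectors -/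

section ZeroPadded

variable {ι κ : Type*} {K : Type*} [NormedAddCommGroup K] [InnerProductSpace ℂ K]

/-- A family whose non-zero members form an orthonormal basis. Gram–Schmidt turns a total sequence
into such a family, depending measurably on the sequence, while a choice of index set for a true
basis would not be uniform over the points of a measurable field. -/
structure IsZeroPaddedBasis (f : ι → K) : Prop where
  eq_zero_or_norm : ∀ i, f i = 0 ∨ ‖f i‖ = 1
  orthogonal : Pairwise fun i j => ⟪f i, f j⟫_ℂ = 0
  dense_span : Dense (Submodule.span ℂ (Set.range f) : Set K)

namespace IsZeroPaddedBasis

/-- The Hilbert basis of non-zero members. -/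
noncomputable def hilbertBasis [CompleteSpace K] {f : ι → K} (hf : IsZeroPaddedBasis f) :
    HilbertBasis {i // f i ≠ 0} ℂ K :=
  HilbertBasis.mk (v := fun i : {i // f i ≠ 0} => f i)
    ⟨fun i => (hf.eq_zero_or_norm i).resolve_left i.2,
      fun i j hij => hf.orthogonal (fun h => hij (Subtype.ext h))⟩ (by
    have h : Submodule.span ℂ (Set.range fun i : {i // f i ≠ 0} => f i) =
        Submodule.span ℂ (Set.range f) := by
      refine le_antisymm (Submodule.span_mono ?_) (Submodule.span_le.2 ?_)
      · rintro _ ⟨i, rfl⟩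
        exact ⟨i, rfl⟩
      · rintro _ ⟨i, rfl⟩
        by_cases hi : f i = 0
        · rw [hi]
          exact Submodule.zero_mem _
        · exact Submodule.subset_span ⟨⟨i, hi⟩, rfl⟩
    rw [h, (Submodule.dense_iff_topologicalClosure_eq_top.1 hf.dense_span)])

lemma hilbertBasis_apply [CompleteSpace K] {f : ι → K} (hf : IsZeroPaddedBasis f)
    (i : {i // f i ≠ 0}) : hf.hilbertBasis i = f i := by
  have h := fun h1 h2 => congrFun
    (HilbertBasis.coe_mk (𝕜 := ℂ) (v := fun i : {i // f i ≠ 0} => f i) h1 h2) i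
  exact h _ _

lemma hasSum_repr [CompleteSpace K] {f : ι → K} (hf : IsZeroPaddedBasis f) (x : K) :
    HasSum (fun i => ⟪f i, x⟫_ℂ • f i) x := by
  have h := hf.hilbertBasis.hasSum_repr x
  simp only [HilbertBasis.repr_apply_apply, hilbertBasis_apply] at h
  refine (hasSum_subtype_iff_of_support_subset (s := {i | f i ≠ 0})
    (f := fun i => ⟪f i, x⟫_ℂ • f i) ?_).1 h
  intro i hi h0
  exact hi (by simp [h0])

lemma hasSum_inner_mul_inner [CompleteSpace K] {f : ι → K} (hf : IsZeroPaddedBasis f) (x y : K) :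
    HasSum (fun i => ⟪x, f i⟫_ℂ * ⟪f i, y⟫_ℂ) ⟪x, y⟫_ℂ := by
  have h := (innerSL ℂ x).hasSum (hf.hasSum_repr y)
  simpa [inner_smul_right, mul_comm] using h

lemma gramSchmidtNormed {e : ℕ → K} (he : Dense (Submodule.span ℂ (Set.range e) : Set K)) :
    IsZeroPaddedBasis (InnerProductSpace.gramSchmidtNormed ℂ e) where
  eq_zero_or_norm i := by
    by_cases h : InnerProductSpace.gramSchmidtNormed ℂ e i = 0
    · exact Or.inl h
    · exact Or.inr (InnerProductSpace.gramSchmidtNormed_unit_length' h)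
  orthogonal i j hij := by
    simp only [InnerProductSpace.gramSchmidtNormed, inner_smul_left, inner_smul_right]
    rw [InnerProductSpace.gramSchmidt_orthogonal ℂ e hij]
    simp
  dense_span := by
    rw [InnerProductSpace.span_gramSchmidtNormed_range, InnerProductSpace.span_gramSchmidt]
    exact he

end IsZeroPaddedBasis

lemma exists_isZeroPaddedBasis_nat [TopologicalSpace.SeparableSpace K] :
    ∃ f : ℕ → K, IsZeroPaddedBasis f :=
  ⟨_, IsZeroPaddedBasis.gramSchmidtNormed (e := TopologicalSpace.denseSeq K)
    ((TopologicalSpace.denseRange_denseSeq K).mono Submodule.subset_span)⟩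

end ZeroPadded

/-! ### Unitary actions `K ⊗ H ≅ L` -/

/-- `φ : K → B(H, L)` encodes a unitary operator `K ⊗ H → L`, `u ⊗ ξ ↦ φ u ξ`. -/
structure IsUnitaryAction {K H L : Type*} [NormedAddCommGroup K] [InnerProductSpace ℂ K]
    [NormedAddCommGroup H] [InnerProductSpace ℂ H] [NormedAddCommGroup L] [InnerProductSpace ℂ L]
    (φ : K →ₗ[ℂ] H →L[ℂ] L) : Prop where
  inner_apply : ∀ u v ξ η, ⟪φ u ξ, φ v η⟫_ℂ = ⟪u, v⟫_ℂ * ⟪ξ, η⟫_ℂ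
  dense_span : Dense (Submodule.span ℂ {ζ | ∃ u ξ, ζ = φ u ξ} : Set L)

lemma continuous_induced_of_comp_eq {X J Z : Type*} [TopologicalSpace Z] (F : X → J → Z)
    (f : X → X) (T : J → J) (h : ∀ A p, F (f A) p = F A (T p)) :
    @Continuous _ _ (TopologicalSpace.induced F inferInstance)
      (TopologicalSpace.induced F inferInstance) f := by
  let _ := TopologicalSpace.induced F inferInstance
  refine continuous_induced_rng.2 (continuous_pi fun p => ?_)
  have h1 : Continuous fun A => F A (T p) := (continuous_apply (T p)).comp continuous_induced_dom
  exact h1.congr fun A => (h A p).symm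

namespace IsUnitaryAction

section General

variable {ι κ : Type*} {K H L : Type*} [NormedAddCommGroup K] [InnerProductSpace ℂ K]
  [NormedAddCommGroup H] [InnerProductSpace ℂ H] [NormedAddCommGroup L] [InnerProductSpace ℂ L]
  {φ : K →ₗ[ℂ] H →L[ℂ] L}

lemma norm_apply (hφ : IsUnitaryAction φ) (u : K) (ξ : H) : ‖φ u ξ‖ = ‖u‖ * ‖ξ‖ := by
  have h := hφ.inner_apply u u ξ ξ
  simp only [inner_self_eq_norm_sq_to_K] at h
  have h' : ‖φ u ξ‖ ^ 2 = (‖u‖ * ‖ξ‖) ^ 2 := by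
    rw [mul_pow]
    exact_mod_cast h
  exact (sq_eq_sq₀ (norm_nonneg _) (by positivity)).1 h'

/-- The action as a bounded bilinear map. -/
noncomputable def toCLM (hφ : IsUnitaryAction φ) : K →L[ℂ] H →L[ℂ] L :=
  φ.mkContinuous 1 fun u => by
    rw [one_mul]
    exact ContinuousLinearMap.opNorm_le_bound _ (norm_nonneg _) fun ξ => (hφ.norm_apply u ξ).le

lemma continuous (hφ : IsUnitaryAction φ) : Continuous φ := hφ.toCLM.continuous

lemma ext_of_apply (hφ : IsUnitaryAction φ) {A B : L →L[ℂ] L}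
    (h : ∀ u ξ, A (φ u ξ) = B (φ u ξ)) : A = B := by
  refine ContinuousLinearMap.ext_on hφ.dense_span ?_
  rintro _ ⟨u, ξ, rfl⟩
  exact h u ξ

lemma eq_zero_of_inner (hφ : IsUnitaryAction φ) {ζ : L} (h : ∀ u ξ, ⟪φ u ξ, ζ⟫_ℂ = 0) : ζ = 0 := by
  have h1 : innerSL ℂ ζ = 0 := by
    refine ContinuousLinearMap.ext_on hφ.dense_span ?_
    rintro _ ⟨u, ξ, rfl⟩
    simpa using inner_eq_zero_symm.1 (h u ξ)
  exact (inner_self_eq_zero (𝕜 := ℂ)).1 (DFunLike.congr_fun h1 ζ)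

lemma isZeroPaddedBasis (hφ : IsUnitaryAction φ) {f : ι → K} {h : κ → H}
    (hf : IsZeroPaddedBasis f) (hh : IsZeroPaddedBasis h) :
    IsZeroPaddedBasis fun p : ι × κ => φ (f p.1) (h p.2) where
  eq_zero_or_norm p := by
    rw [hφ.norm_apply]
    rcases hf.eq_zero_or_norm p.1 with h1 | h1
    · simp [h1]
    rcases hh.eq_zero_or_norm p.2 with h2 | h2
    · simp [h2]
    · simp [h1, h2]
  orthogonal p q hpq := by
    change ⟪φ (f p.1) (h p.2), φ (f q.1) (h q.2)⟫_ℂ = 0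
    rw [hφ.inner_apply]
    by_cases h1 : p.1 = q.1
    · rw [hh.orthogonal (fun h2 => hpq (Prod.ext h1 h2)), mul_zero]
    · rw [hf.orthogonal h1, zero_mul]
  dense_span := by
    set S := Submodule.span ℂ (Set.range fun p : ι × κ => φ (f p.1) (h p.2))
    have key : ∀ u ξ, φ u ξ ∈ S.topologicalClosure := by
      intro u
      have h1 : Submodule.span ℂ (Set.range f) ≤
          { carrier := {u | ∀ ξ, φ u ξ ∈ S.topologicalClosure}
            zero_mem' := fun ξ => by simp
            add_mem' := fun {a b} ha hb ξ => by
              rw [map_add, _root_.add_apply]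
              exact add_mem (ha ξ) (hb ξ)
            smul_mem' := fun c a ha ξ => by
              rw [map_smul, _root_.smul_apply]
              exact Submodule.smul_mem _ c (ha ξ) } := by
        refine Submodule.span_le.2 ?_
        rintro _ ⟨i, rfl⟩ ξ
        have h2 : Submodule.span ℂ (Set.range h) ≤
            S.topologicalClosure.comap (φ (f i)).toLinearMap := by
          refine Submodule.span_le.2 ?_
          rintro _ ⟨j, rfl⟩
          exact S.le_topologicalClosure (Submodule.subset_span ⟨(i, j), rfl⟩)
        have h3 : IsClosed (S.topologicalClosure.comap (φ (f i)).toLinearMap : Set H) :=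
          S.isClosed_topologicalClosure.preimage (φ (f i)).continuous
        exact closure_minimal h2 h3 (hh.dense_span ξ)
      intro ξ
      have h3 : IsClosed {u | φ u ξ ∈ S.topologicalClosure} :=
        S.isClosed_topologicalClosure.preimage (hφ.continuous.clm_apply continuous_const)
      exact closure_minimal (fun v hv => h1 hv ξ) h3 (hf.dense_span u)
    have h4 : Submodule.span ℂ {ζ | ∃ u ξ, ζ = φ u ξ} ≤ S.topologicalClosure := by
      refine Submodule.span_le.2 ?_
      rintro _ ⟨u, ξ, rfl⟩
      exact key u ξ
    intro ζ
    exact closure_minimal h4 S.isClosed_topologicalClosure (hφ.dense_span ζ)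

variable [CompleteSpace H] [CompleteSpace L]

/-- The decomposition `L = ⨁ φ (f i) H`. -/
lemma hasSum_apply_adjoint [TopologicalSpace.SeparableSpace H] (hφ : IsUnitaryAction φ) {f : ι → K}
    (hf : IsZeroPaddedBasis f) (ζ : L) :
    HasSum (fun i => φ (f i) (ContinuousLinearMap.adjoint (φ (f i)) ζ)) ζ := by
  obtain ⟨h, hh⟩ := exists_isZeroPaddedBasis_nat (K := H)
  refine ((hφ.isZeroPaddedBasis hf hh).hasSum_repr ζ).prod_fiberwise fun i => ?_
  have h1 := (φ (f i)).hasSum (hh.hasSum_repr (ContinuousLinearMap.adjoint (φ (f i)) ζ))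
  simpa only [map_smul, ContinuousLinearMap.adjoint_inner_right] using h1

/-- The partial sums of `hasSum_apply_adjoint` are orthogonal projections. -/
lemma norm_sub_sum_le (hφ : IsUnitaryAction φ) {f : ι → K} (hf : IsZeroPaddedBasis f) (s : Finset ι)
    (ζ : L) : ‖ζ - ∑ i ∈ s, φ (f i) (ContinuousLinearMap.adjoint (φ (f i)) ζ)‖ ≤ ‖ζ‖ := by
  set p := ∑ i ∈ s, φ (f i) (ContinuousLinearMap.adjoint (φ (f i)) ζ) with hp
  have h1 : ∀ i ∈ s, ∀ ξ, ⟪φ (f i) ξ, ζ - p⟫_ℂ = 0 := by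
    intro i hi ξ
    rw [inner_sub_right, hp, inner_sum, Finset.sum_eq_single i]
    · rcases hf.eq_zero_or_norm i with h | h
      · simp [h]
      · rw [hφ.inner_apply, inner_self_eq_norm_sq_to_K, h,
          ContinuousLinearMap.adjoint_inner_right]
        simp
    · intro j _ hj
      rw [hφ.inner_apply, hf.orthogonal hj.symm, zero_mul]
    · exact fun h => absurd hi h
  have h2 : ⟪p, ζ - p⟫_ℂ = 0 := by
    rw [show ⟪p, ζ - p⟫_ℂ = ⟪∑ i ∈ s, φ (f i) (ContinuousLinearMap.adjoint (φ (f i)) ζ), ζ - p⟫_ℂ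
      from rfl, sum_inner]
    exact Finset.sum_eq_zero fun i hi => h1 i hi _
  have h3 := norm_add_sq_eq_norm_sq_add_norm_sq_of_inner_eq_zero p (ζ - p) h2
  rw [add_sub_cancel] at h3
  nlinarith [norm_nonneg ζ, norm_nonneg (ζ - p), norm_nonneg p]

end General

/-! ### Amplification of operators along `K ⊗ H ≅ H` -/

variable {ι κ : Type*} {K H : Type*} [NormedAddCommGroup K] [InnerProductSpace ℂ K]
  [NormedAddCommGroup H] [InnerProductSpace ℂ H] {φ : K →ₗ[ℂ] H →L[ℂ] H}

variable [CompleteSpace H]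

lemma adjoint_apply (hφ : IsUnitaryAction φ) (u v : K) (ξ : H) :
    star (φ u) (φ v ξ) = ⟪u, v⟫_ℂ • ξ := by
  refine ext_inner_left ℂ fun η => ?_
  rw [ContinuousLinearMap.star_eq_adjoint, ContinuousLinearMap.adjoint_inner_right,
    hφ.inner_apply, inner_smul_right]

lemma hasSum_coefficients [CompleteSpace K] (hφ : IsUnitaryAction φ) {f : ι → K} {h : κ → H}
    (hf : IsZeroPaddedBasis f) (hh : IsZeroPaddedBasis h) {A B : H →L[ℂ] H}
    (hA : ∀ u, B * φ u = φ u * A) (η ξ : H) :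
    HasSum (fun p : ι × κ => ⟪η, φ (f p.1) (A (h p.2))⟫_ℂ * ⟪φ (f p.1) (h p.2), ξ⟫_ℂ)
      ⟪η, B ξ⟫_ℂ := by
  have h1 := (hφ.isZeroPaddedBasis hf hh).hasSum_inner_mul_inner (star B η) ξ
  rw [ContinuousLinearMap.star_eq_adjoint, ContinuousLinearMap.adjoint_inner_left] at h1
  convert h1 using 2 with p
  rw [ContinuousLinearMap.adjoint_inner_left]
  exact congrArg (fun ζ => ⟪η, ζ⟫_ℂ * _) (DFunLike.congr_fun (hA (f p.1)) (h p.2)).symm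

lemma hasSum_inner_adjoint [CompleteSpace K] [TopologicalSpace.SeparableSpace H]
    (hφ : IsUnitaryAction φ) {f : ι → K}
    (hf : IsZeroPaddedBasis f) {A B : H →L[ℂ] H}
    (hA : ∀ u, B * φ u = φ u * A) (η ξ : H) :
    HasSum (fun i => ⟪star (φ (f i)) η, A (star (φ (f i)) ξ)⟫_ℂ) ⟪η, B ξ⟫_ℂ := by
  obtain ⟨h, hh⟩ := exists_isZeroPaddedBasis_nat (K := H)
  refine (hφ.hasSum_coefficients hf hh hA η ξ).prod_fiberwise fun i => ?_
  have h1 := hh.hasSum_inner_mul_inner (star A (star (φ (f i)) η)) (star (φ (f i)) ξ)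
  simp only [ContinuousLinearMap.star_eq_adjoint] at h1 ⊢
  rw [ContinuousLinearMap.adjoint_inner_left A] at h1
  convert h1 using 1
  funext j
  rw [ContinuousLinearMap.adjoint_inner_left, ContinuousLinearMap.adjoint_inner_left,
    ContinuousLinearMap.adjoint_inner_right]

/-- Parseval's identity for the decomposition `H = ⨁ φ (f i) H`. -/
lemma hasSum_norm_sq [CompleteSpace K] [TopologicalSpace.SeparableSpace H]
    (hφ : IsUnitaryAction φ) {f : ι → K} (hf : IsZeroPaddedBasis f) (ξ : H) :
    HasSum (fun i => ‖star (φ (f i)) ξ‖ ^ 2) (‖ξ‖ ^ 2) := by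
  have h := hφ.hasSum_inner_adjoint hf (A := 1) (B := 1) (fun u => by rw [one_mul, mul_one]) ξ ξ
  simp only [one_apply_eq_self, inner_self_eq_norm_sq_to_K] at h
  exact_mod_cast h

/-- The operator `ξ ↦ (A T_i* ξ)_i` into the direct sum of copies of `H`, where `T_i = φ (f i)`. -/
noncomputable def column [CompleteSpace K] [TopologicalSpace.SeparableSpace H]
    (hφ : IsUnitaryAction φ) {f : ι → K} (hf : IsZeroPaddedBasis f) (A : H →L[ℂ] H) :
    H →L[ℂ] lp (fun _ : ι => H) 2 :=
  have hb : ∀ ξ i, ‖A (star (φ (f i)) ξ)‖ ^ (2 : ENNReal).toReal ≤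
      ‖A‖ ^ 2 * ‖star (φ (f i)) ξ‖ ^ 2 := fun ξ i => by
    rw [ENNReal.toReal_ofNat, Real.rpow_ofNat, ← mul_pow]
    gcongr
    exact A.le_opNorm _
  have hs : ∀ ξ, Summable fun i => ‖A (star (φ (f i)) ξ)‖ ^ (2 : ENNReal).toReal := fun ξ =>
    ((hφ.hasSum_norm_sq hf ξ).summable.mul_left (‖A‖ ^ 2)).of_nonneg_of_le
      (fun i => by positivity) (hb ξ)
  LinearMap.mkContinuous
    { toFun := fun ξ => ⟨fun i => A (star (φ (f i)) ξ), memℓp_gen (hs ξ)⟩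
      map_add' := fun ξ η => by
        ext i
        exact ((A ∘L star (φ (f i))).map_add ξ η)
      map_smul' := fun c ξ => by
        ext i
        exact ((A ∘L star (φ (f i))).map_smul c ξ) } ‖A‖ fun ξ => by
    refine lp.norm_le_of_tsum_le (by simp) (by positivity) ?_
    refine ((hs ξ).tsum_le_tsum (hb ξ)
      ((hφ.hasSum_norm_sq hf ξ).summable.mul_left (‖A‖ ^ 2))).trans_eq ?_
    rw [((hφ.hasSum_norm_sq hf ξ).mul_left (‖A‖ ^ 2)).tsum_eq, ENNReal.toReal_ofNat,
      Real.rpow_ofNat, mul_pow]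

lemma exists_amplification [CompleteSpace K] [TopologicalSpace.SeparableSpace H]
    [TopologicalSpace.SeparableSpace K] (hφ : IsUnitaryAction φ) (A : H →L[ℂ] H) :
    ∃ B : H →L[ℂ] H, ∀ u, B * φ u = φ u * A := by
  obtain ⟨f, hf⟩ := exists_isZeroPaddedBasis_nat (K := K)
  refine ⟨ContinuousLinearMap.adjoint (hφ.column hf 1) ∘L hφ.column hf A, fun v => ?_⟩
  ext ξ
  refine eq_of_sub_eq_zero (hφ.eq_zero_of_inner fun u η => ?_)
  rw [inner_sub_right, sub_eq_zero]
  change ⟪φ u η, ContinuousLinearMap.adjoint (hφ.column hf 1) (hφ.column hf A (φ v ξ))⟫_ℂ =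
    ⟪φ u η, φ v (A ξ)⟫_ℂ
  rw [ContinuousLinearMap.adjoint_inner_right, hφ.inner_apply]
  have h1 : ∀ i, ⟪hφ.column hf 1 (φ u η) i, hφ.column hf A (φ v ξ) i⟫_ℂ =
      ⟪u, f i⟫_ℂ * ⟪f i, v⟫_ℂ * ⟪η, A ξ⟫_ℂ := fun i => by
    change ⟪star (φ (f i)) (φ u η), A (star (φ (f i)) (φ v ξ))⟫_ℂ = _
    rw [hφ.adjoint_apply, hφ.adjoint_apply, map_smul, inner_smul_left, inner_smul_right,
      inner_conj_symm]
    ring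
  rw [lp.inner_eq_tsum, tsum_congr h1]
  exact ((hf.hasSum_inner_mul_inner u v).mul_right _).tsum_eq

variable [CompleteSpace K] [TopologicalSpace.SeparableSpace H] [TopologicalSpace.SeparableSpace K]

/-- The unital `*`-endomorphism `A ↦ 1 ⊗ A` of `B(H)`, transported along `K ⊗ H ≅ H`. It is
determined by the relation `amplification_mul`. -/
noncomputable def amplification (hφ : IsUnitaryAction φ) : (H →L[ℂ] H) →⋆ₐ[ℂ] (H →L[ℂ] H) :=
  have spec := fun A => (hφ.exists_amplification A).choose_spec
  have apply := fun A u ξ => DFunLike.congr_fun (spec A u) ξ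
  have uniq : ∀ A B, (∀ u ξ, B (φ u ξ) = φ u (A ξ)) → (hφ.exists_amplification A).choose = B :=
    fun A B h => hφ.ext_of_apply fun u ξ => (apply A u ξ).trans (h u ξ).symm
  { toFun := fun A => (hφ.exists_amplification A).choose
    map_one' := uniq _ _ fun u ξ => rfl
    map_mul' := fun A B => uniq _ _ fun u ξ => by
      have h := apply B u ξ
      simp only [mul_apply_eq_comp] at h
      simp only [mul_apply_eq_comp, h]
      exact apply A u (B ξ)
    map_zero' := uniq _ _ fun u ξ => by simp
    map_add' := fun A B => uniq _ _ fun u ξ => by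
      rw [_root_.add_apply, _root_.add_apply, map_add]
      exact congrArg₂ _ (apply A u ξ) (apply B u ξ)
    commutes' := fun c => uniq _ _ fun u ξ => by
      simp [Algebra.algebraMap_eq_smul_one]
    map_star' := fun A => uniq _ _ fun u ξ => by
      refine eq_of_sub_eq_zero (hφ.eq_zero_of_inner fun v η => ?_)
      have h : (hφ.exists_amplification A).choose (φ v η) = φ v (A η) := apply A v η
      rw [inner_sub_right, sub_eq_zero, ContinuousLinearMap.star_eq_adjoint,
        ContinuousLinearMap.adjoint_inner_right, h, hφ.inner_apply, hφ.inner_apply,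
        ContinuousLinearMap.star_eq_adjoint, ContinuousLinearMap.adjoint_inner_right] }

lemma amplification_mul (hφ : IsUnitaryAction φ) (A : H →L[ℂ] H) (u : K) :
    hφ.amplification A * φ u = φ u * A :=
  (hφ.exists_amplification A).choose_spec u

lemma eq_amplification (hφ : IsUnitaryAction φ) {A B : H →L[ℂ] H}
    (h : ∀ u, B * φ u = φ u * A) : B = hφ.amplification A :=
  hφ.ext_of_apply fun u ξ =>
    DFunLike.congr_fun ((h u).trans (hφ.amplification_mul A u).symm) ξ

lemma isNormalMap_amplification (hφ : IsUnitaryAction φ) : IsNormalMap H hφ.amplification := by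
  obtain ⟨f, hf⟩ := exists_isZeroPaddedBasis_nat (K := K)
  let e : ℕ ≃ ℕ × ℕ := (Denumerable.eqv (ℕ × ℕ)).symm
  -- the doubly indexed family `(T_i* ξ_n)_{n, i}` is again square summable
  have hs : ∀ ξ : SquareSummableSeq H,
      Summable fun p : ℕ × ℕ => ‖star (φ (f p.2)) (ξ.1 p.1)‖ ^ 2 := fun ξ => by
    rw [summable_prod_of_nonneg fun p => by positivity]
    exact ⟨fun n => (hφ.hasSum_norm_sq hf (ξ.1 n)).summable, by
      simpa only [fun n => (hφ.hasSum_norm_sq hf (ξ.1 n)).tsum_eq] using ξ.2⟩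
  let T : SquareSummableSeq H → SquareSummableSeq H := fun ξ =>
    ⟨fun k => star (φ (f (e k).2)) (ξ.1 (e k).1), (e.summable_iff
      (f := fun p : ℕ × ℕ => ‖star (φ (f p.2)) (ξ.1 p.1)‖ ^ 2)).2 (hs ξ)⟩
  have key : ∀ (A : H →L[ℂ] H) (ξ η : SquareSummableSeq H),
      ∑' n, ⟪η.1 n, hφ.amplification A (ξ.1 n)⟫_ℂ = ∑' k, ⟪(T η).1 k, A ((T ξ).1 k)⟫_ℂ := by
    intro A ξ η
    have hsum : Summable fun p : ℕ × ℕ =>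
        ⟪star (φ (f p.2)) (η.1 p.1), A (star (φ (f p.2)) (ξ.1 p.1))⟫_ℂ := by
      refine Summable.of_norm_bounded
        (((hs η).add (hs ξ)).mul_left ‖A‖) fun p => ?_
      have h1 := norm_inner_le_norm (𝕜 := ℂ) (star (φ (f p.2)) (η.1 p.1))
        (A (star (φ (f p.2)) (ξ.1 p.1)))
      have h2 := A.le_opNorm (star (φ (f p.2)) (ξ.1 p.1))
      set a := ‖star (φ (f p.2)) (η.1 p.1)‖
      set b := ‖star (φ (f p.2)) (ξ.1 p.1)‖
      calc _ ≤ a * (‖A‖ * b) := h1.trans (by gcongr)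
        _ = ‖A‖ * (a * b) := by ring
        _ ≤ ‖A‖ * (a ^ 2 + b ^ 2) := by
          gcongr
          nlinarith [sq_nonneg (a - b), sq_nonneg a, sq_nonneg b]
    rw [show (∑' k, ⟪(T η).1 k, A ((T ξ).1 k)⟫_ℂ) = ∑' p : ℕ × ℕ,
        ⟪star (φ (f p.2)) (η.1 p.1), A (star (φ (f p.2)) (ξ.1 p.1))⟫_ℂ from
      e.tsum_eq fun p : ℕ × ℕ =>
        ⟪star (φ (f p.2)) (η.1 p.1), A (star (φ (f p.2)) (ξ.1 p.1))⟫_ℂ, hsum.tsum_prod]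
    exact tsum_congr fun n =>
      (hφ.hasSum_inner_adjoint hf (hφ.amplification_mul A) (η.1 n) (ξ.1 n)).tsum_eq.symm
  exact continuous_induced_of_comp_eq _ _ (fun p => (T p.1, T p.2)) fun A p => key A p.1 p.2

end IsUnitaryAction

/-! ### The product and the measurable sections of a product system -/

namespace ProductSystemData

section Algebraic

variable {P : Type v} [Mul P] {E : ProductSystemData.{u} P}

namespace IsAlgebraic

lemma inner_mul_mul (hE : E.IsAlgebraic) {x y : P} (a b : E.fiber x) (c d : E.fiber y) :
    ⟪E.mul a c, E.mul b d⟫_ℂ = ⟪a, b⟫_ℂ * ⟪c, d⟫_ℂ := by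
  obtain ⟨U, hU⟩ := hE.exists_unitary x y
  rw [← hU, ← hU, U.inner_map_map, UniformSpace.Completion.inner_coe, TensorProduct.inner_tmul]

lemma norm_mul (hE : E.IsAlgebraic) {x y : P} (a : E.fiber x) (b : E.fiber y) :
    ‖E.mul a b‖ = ‖a‖ * ‖b‖ := by
  obtain ⟨U, hU⟩ := hE.exists_unitary x y
  rw [← hU, U.norm_map, UniformSpace.Completion.norm_coe, TensorProduct.norm_tmul]

lemma add_mul (hE : E.IsAlgebraic) {x y : P} (a b : E.fiber x) (c : E.fiber y) :
    E.mul (a + b) c = E.mul a c + E.mul b c := by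
  obtain ⟨U, hU⟩ := hE.exists_unitary x y
  rw [← hU, ← hU, ← hU, TensorProduct.add_tmul, UniformSpace.Completion.coe_add, map_add]

lemma mul_add (hE : E.IsAlgebraic) {x y : P} (a : E.fiber x) (b c : E.fiber y) :
    E.mul a (b + c) = E.mul a b + E.mul a c := by
  obtain ⟨U, hU⟩ := hE.exists_unitary x y
  rw [← hU, ← hU, ← hU, TensorProduct.tmul_add, UniformSpace.Completion.coe_add, map_add]

lemma smul_mul (hE : E.IsAlgebraic) {x y : P} (k : ℂ) (a : E.fiber x) (c : E.fiber y) :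
    E.mul (k • a) c = k • E.mul a c := by
  obtain ⟨U, hU⟩ := hE.exists_unitary x y
  rw [← hU, ← hU, ← TensorProduct.smul_tmul', UniformSpace.Completion.coe_smul, map_smul]

lemma mul_smul (hE : E.IsAlgebraic) {x y : P} (k : ℂ) (a : E.fiber x) (c : E.fiber y) :
    E.mul a (k • c) = k • E.mul a c := by
  obtain ⟨U, hU⟩ := hE.exists_unitary x y
  rw [← hU, ← hU, TensorProduct.tmul_smul, UniformSpace.Completion.coe_smul, map_smul]

/-- Products are total in the fibre over a product. -/
lemma dense_span_mul (hE : E.IsAlgebraic) (x y : P) :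
    Dense (Submodule.span ℂ {c | ∃ (a : E.fiber x) (b : E.fiber y), c = E.mul a b} :
      Set (E.fiber (x * y))) := by
  obtain ⟨U, hU⟩ := hE.exists_unitary x y
  have h1 : DenseRange fun t : E.fiber x ⊗[ℂ] E.fiber y =>
      U (t : UniformSpace.Completion (E.fiber x ⊗[ℂ] E.fiber y)) :=
    U.surjective.denseRange.comp UniformSpace.Completion.denseRange_coe U.continuous
  refine h1.mono ?_
  rintro _ ⟨t, rfl⟩
  induction t with
  | zero =>
    change U ((0 : E.fiber x ⊗[ℂ] E.fiber y) :
      UniformSpace.Completion (E.fiber x ⊗[ℂ] E.fiber y)) ∈ _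
    rw [UniformSpace.Completion.coe_zero, map_zero]
    exact Submodule.zero_mem _
  | tmul a b => exact Submodule.subset_span ⟨a, b, hU a b⟩
  | add s t hs ht =>
    simp only [UniformSpace.Completion.coe_add, map_add]
    exact Submodule.add_mem _ hs ht

lemma mul_assoc (hE : E.IsAlgebraic) (x y z : P) : x * y * z = x * (y * z) :=
  congrArg Sigma.fst (hE.assoc (0 : E.fiber x) (0 : E.fiber y) (0 : E.fiber z))

/-- Left multiplication by a vector. -/
noncomputable def mulLeft (hE : E.IsAlgebraic) {x : P} (y : P) (a : E.fiber x) :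
    E.fiber y →L[ℂ] E.fiber (x * y) :=
  LinearMap.mkContinuous
    { toFun := fun b => E.mul a b
      map_add' := hE.mul_add a
      map_smul' := fun k b => hE.mul_smul k a b } ‖a‖ fun b => (hE.norm_mul a b).le

@[simp] lemma mulLeft_apply (hE : E.IsAlgebraic) {x y : P} (a : E.fiber x) (b : E.fiber y) :
    hE.mulLeft y a b = E.mul a b := rfl

lemma norm_mulLeft_apply (hE : E.IsAlgebraic) {x : P} (a : E.fiber x) (y : P) (b : E.fiber y) :
    ‖hE.mulLeft y a b‖ = ‖a‖ * ‖b‖ := hE.norm_mul a b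

/-- Right multiplication by a vector. -/
noncomputable def mulRight (hE : E.IsAlgebraic) (x : P) {y : P} (b : E.fiber y) :
    E.fiber x →L[ℂ] E.fiber (x * y) :=
  LinearMap.mkContinuous
    { toFun := fun a => E.mul a b
      map_add' := fun a a' => hE.add_mul a a' b
      map_smul' := fun k a => hE.smul_mul k a b } ‖b‖ fun a => by
    rw [mul_comm]
    exact (hE.norm_mul a b).le

@[simp] lemma mulRight_apply (hE : E.IsAlgebraic) {x y : P} (a : E.fiber x) (b : E.fiber y) :
    hE.mulRight x b a = E.mul a b := rfl

lemma norm_mulRight_apply (hE : E.IsAlgebraic) {x y : P} (a : E.fiber x) (b : E.fiber y) :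
    ‖hE.mulRight x b a‖ = ‖b‖ * ‖a‖ := (hE.norm_mul a b).trans (mul_comm _ _)

/-- Left multiplication implements the unitary operator `E(x) ⊗ E(y) ≅ E(xy)`. -/
lemma isUnitaryAction_mulLeft (hE : E.IsAlgebraic) (x y : P) :
    IsUnitaryAction (LinearMap.mk
      (AddHom.mk (fun a => hE.mulLeft (x := x) y a) fun a b => by ext c; exact hE.add_mul a b c)
      fun k a => by ext c; exact hE.smul_mul k a c :
      E.fiber x →ₗ[ℂ] E.fiber y →L[ℂ] E.fiber (x * y)) where
  inner_apply := hE.inner_mul_mul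
  dense_span := hE.dense_span_mul x y

/-- Associativity, evaluated along a section, which takes care of the change of fibre. -/
lemma section_assoc (hE : E.IsAlgebraic) (F : ∀ x, E.fiber x) {x y z : P}
    {a : E.fiber x} {b : E.fiber y} {c : E.fiber z} :
    F (x * y * z) = E.mul (E.mul a b) c ↔ F (x * (y * z)) = E.mul a (E.mul b c) := by
  have h1 : (⟨x * y * z, F (x * y * z)⟩ : Σ t, E.fiber t) = ⟨x * (y * z), F (x * (y * z))⟩ := by
    rw [hE.mul_assoc]
  have h2 := hE.assoc a b c
  constructor
  · intro h3
    rw [h3, h2] at h1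
    exact (eq_of_heq (Sigma.mk.inj h1).2).symm
  · intro h3
    rw [h3, ← h2] at h1
    exact eq_of_heq (Sigma.mk.inj h1).2

end IsAlgebraic

end Algebraic

section Measurable

variable {P : Type v} [MeasurableSpace P] [Mul P] {E : ProductSystemData.{u} P}

namespace IsMeasurableField

lemma zero_mem (hE : E.IsMeasurableField) : (0 : ∀ x, E.fiber x) ∈ E.sections :=
  hE.mem_of_measurable_inner _ fun r _ => by simp

lemma add_mem (hE : E.IsMeasurableField) {r s : ∀ x, E.fiber x} (hr : r ∈ E.sections)
    (hs : s ∈ E.sections) : r + s ∈ E.sections :=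
  hE.mem_of_measurable_inner _ fun t ht => by
    simp only [Pi.add_apply, inner_add_right]
    exact (hE.measurable_inner t ht r hr).add (hE.measurable_inner t ht s hs)

lemma smul_mem (hE : E.IsMeasurableField) {c : P → ℂ} (hc : Measurable c) {s : ∀ x, E.fiber x}
    (hs : s ∈ E.sections) : (fun x => c x • s x) ∈ E.sections :=
  hE.mem_of_measurable_inner _ fun t ht => by
    simp only [inner_smul_right]
    exact hc.mul (hE.measurable_inner t ht s hs)

lemma const_smul_mem (hE : E.IsMeasurableField) (c : ℂ) {s : ∀ x, E.fiber x}
    (hs : s ∈ E.sections) : c • s ∈ E.sections := hE.smul_mem measurable_const hs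

lemma sub_mem (hE : E.IsMeasurableField) {r s : ∀ x, E.fiber x} (hr : r ∈ E.sections)
    (hs : s ∈ E.sections) : r - s ∈ E.sections := by
  have h := hE.add_mem hr (hE.const_smul_mem (-1) hs)
  rwa [neg_one_smul, ← sub_eq_add_neg] at h

lemma sum_mem (hE : E.IsMeasurableField) {ι : Type*} (t : Finset ι) {s : ι → ∀ x, E.fiber x}
    (hs : ∀ i ∈ t, s i ∈ E.sections) : (∑ i ∈ t, s i) ∈ E.sections := by
  classical
  induction t using Finset.induction_on with
  | empty => exact hE.zero_mem
  | insert i t hi ih =>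
    rw [Finset.sum_insert hi]
    exact hE.add_mem (hs i (Finset.mem_insert_self i t))
      (ih fun j hj => hs j (Finset.mem_insert_of_mem hj))

open Classical in
lemma piecewise_mem (hE : E.IsMeasurableField) {A : Set P} (hA : MeasurableSet A)
    {s : ∀ x, E.fiber x} (hs : s ∈ E.sections) :
    (fun x => if x ∈ A then s x else 0) ∈ E.sections := by
  have h := hE.smul_mem
    (measurable_const.indicator hA : Measurable (A.indicator fun _ => (1 : ℂ))) hs
  convert h using 1
  funext x
  by_cases hx : x ∈ A <;> simp [hx]

open Classical in
/-- Every vector is the value of a measurable section. -/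
lemma single_mem [MeasurableSingletonClass P] (hE : E.IsMeasurableField) {x : P} (v : E.fiber x) :
    (Pi.single x v : ∀ y, E.fiber y) ∈ E.sections := by
  refine hE.mem_of_measurable_inner _ fun t _ => ?_
  have h : (fun y => ⟪t y, (Pi.single x v : ∀ y, E.fiber y) y⟫_ℂ) =
      ({x} : Set P).indicator fun _ => ⟪t x, v⟫_ℂ := by
    funext y
    by_cases hy : y = x
    · subst hy
      simp
    · simp [hy]
  rw [h]
  exact measurable_const.indicator (measurableSet_singleton x)

lemma measurable_norm_sq (hE : E.IsMeasurableField) {s : ∀ x, E.fiber x} (hs : s ∈ E.sections) :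
    Measurable fun x => ‖s x‖ ^ 2 := by
  have h := Complex.measurable_re.comp (hE.measurable_inner s hs s hs)
  convert h using 1
  funext x
  exact (inner_self_eq_norm_sq (𝕜 := ℂ) (s x)).symm

lemma measurable_norm (hE : E.IsMeasurableField) {s : ∀ x, E.fiber x} (hs : s ∈ E.sections) :
    Measurable fun x => ‖s x‖ := by
  have h := (hE.measurable_norm_sq hs).sqrt
  simpa only [Real.sqrt_sq (norm_nonneg _)] using h

lemma gramSchmidt_mem (hE : E.IsMeasurableField) {e : ℕ → ∀ x, E.fiber x}
    (he : ∀ n, e n ∈ E.sections) (n : ℕ) :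
    (fun x => InnerProductSpace.gramSchmidt ℂ (fun m => e m x) n) ∈ E.sections := by
  induction n using Nat.strong_induction_on with
  | _ n ih =>
    have h : (fun x => InnerProductSpace.gramSchmidt ℂ (fun m => e m x) n) =
        e n - ∑ i ∈ Finset.Iio n, fun x =>
          (⟪InnerProductSpace.gramSchmidt ℂ (fun m => e m x) i, e n x⟫_ℂ /
            ((‖InnerProductSpace.gramSchmidt ℂ (fun m => e m x) i‖ ^ 2 : ℝ) : ℂ)) •
            InnerProductSpace.gramSchmidt ℂ (fun m => e m x) i := by
      funext x
      rw [InnerProductSpace.gramSchmidt_def]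
      simp [Submodule.starProjection_singleton]
    rw [h]
    refine hE.sub_mem (he n) (hE.sum_mem _ fun i hi => ?_)
    have hi' := ih i (Finset.mem_Iio.1 hi)
    exact hE.smul_mem ((hE.measurable_inner _ hi' _ (he n)).div
      (Complex.measurable_ofReal.comp (hE.measurable_norm_sq hi'))) hi'

/-- The measurable sections contain a field of zero-padded orthonormal bases. -/
lemma exists_basis (hE : E.IsMeasurableField) : ∃ f : ℕ → ∀ x, E.fiber x,
    (∀ n, f n ∈ E.sections) ∧ ∀ x, IsZeroPaddedBasis fun n => f n x := by
  obtain ⟨e, he, hd⟩ := hE.exists_total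
  refine ⟨fun n x => InnerProductSpace.gramSchmidtNormed ℂ (fun m => e m x) n, fun n => ?_,
    fun x => IsZeroPaddedBasis.gramSchmidtNormed (hd x)⟩
  have h := hE.gramSchmidt_mem he n
  simp only [InnerProductSpace.gramSchmidtNormed]
  convert hE.smul_mem
    (c := fun x => ((‖InnerProductSpace.gramSchmidt ℂ (fun m => e m x) n‖⁻¹ : ℝ) : ℂ))
    (Complex.measurable_ofReal.comp (hE.measurable_norm h).inv) h using 3
  simp

end IsMeasurableField

end Measurable

end ProductSystemData

/-! ### Essential representations and `E₀`-semigroups -/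

/-- An essential representation of a product system on a Hilbert space `H`: a measurable
multiplicative family of unitaries `E(x) ⊗ H ≅ H`, encoded as actions `E(x) → B(H)`. -/
structure EssentialRep {P : Type v} [Mul P] [MeasurableSpace P] (E : ProductSystemData.{u} P)
    (H : Type w) [NormedAddCommGroup H] [InnerProductSpace ℂ H] where
  /-- the action of a vector in `E(x)` -/
  action : ∀ x, E.fiber x →ₗ[ℂ] H →L[ℂ] H
  isUnitaryAction : ∀ x, IsUnitaryAction (action x)
  action_mul : ∀ {x y : P} (a : E.fiber x) (b : E.fiber y),
    action (x * y) (E.mul a b) = action x a * action y b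
  measurable : ∀ s ∈ E.sections, ∀ ξ η : H, Measurable fun x => ⟪η, action x (s x) ξ⟫_ℂ

namespace EssentialRep

variable {P : Type v} [Mul P] [MeasurableSpace P] {E : ProductSystemData.{u} P}

section Transport

variable {H : Type w} [NormedAddCommGroup H] [InnerProductSpace ℂ H]
  {H' : Type*} [NormedAddCommGroup H'] [InnerProductSpace ℂ H']

/-- Transport of a representation along a unitary operator. -/
noncomputable def transport (π : EssentialRep E H) (U : H ≃ₗᵢ[ℂ] H') : EssentialRep E H' where
  action x :=
    { toFun := fun a => (U.toContinuousLinearEquiv : H →L[ℂ] H') ∘L π.action x a ∘L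
        (U.symm.toContinuousLinearEquiv : H' →L[ℂ] H)
      map_add' := fun a b => by
        ext ξ
        simp
      map_smul' := fun c a => by
        ext ξ
        simp }
  isUnitaryAction x :=
    { inner_apply := fun a b ξ η => by
        change ⟪U (π.action x a (U.symm ξ)), U (π.action x b (U.symm η))⟫_ℂ = _
        rw [U.inner_map_map, (π.isUnitaryAction x).inner_apply, U.symm.inner_map_map]
      dense_span := by
        have h := U.surjective.denseRange.dense_image U.continuous (π.isUnitaryAction x).dense_span
        refine h.mono ?_
        rintro _ ⟨ζ, hζ, rfl⟩
        change U.toLinearEquiv.toLinearMap ζ ∈ _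
        rw [SetLike.mem_coe, ← Submodule.mem_comap]
        refine (Submodule.span_le.2 ?_ :
          Submodule.span ℂ {ζ | ∃ u ξ, ζ = π.action x u ξ} ≤ _) hζ
        rintro _ ⟨a, ξ, rfl⟩
        refine Submodule.subset_span ⟨a, U ξ, ?_⟩
        change U (π.action x a ξ) = U (π.action x a (U.symm (U ξ)))
        rw [U.symm_apply_apply] }
  action_mul a b := by
    ext ξ
    change U (π.action _ (E.mul a b) (U.symm ξ)) =
      U (π.action _ a (U.symm (U (π.action _ b (U.symm ξ)))))
    rw [π.action_mul, U.symm_apply_apply]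
    rfl
  measurable s hs ξ η := by
    have h := π.measurable s hs (U.symm ξ) (U.symm η)
    convert h using 1
    funext x
    rw [← U.inner_map_map, U.apply_symm_apply]
    rfl

end Transport

variable {H : Type w} [NormedAddCommGroup H] [InnerProductSpace ℂ H] [CompleteSpace H]
  [TopologicalSpace.SeparableSpace H]

/-- The `E₀`-semigroup implemented by an essential representation. -/
noncomputable def e0Semigroup (π : EssentialRep E H) (hE : E.IsProductSystem) :
    E0Semigroup P H where
  map x :=
    haveI := hE.isAlgebraic.separable x
    (π.isUnitaryAction x).amplification
  normal x :=
    haveI := hE.isAlgebraic.separable x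
    (π.isUnitaryAction x).isNormalMap_amplification
  map_mul x y A := by
    have _ := hE.isAlgebraic.separable
    refine ((π.isUnitaryAction (x * y)).eq_amplification fun c => ?_).symm
    have hd := hE.isAlgebraic.dense_span_mul x y
    set B := (π.isUnitaryAction x).amplification ((π.isUnitaryAction y).amplification A)
    have h : (ContinuousLinearMap.mul ℂ (H →L[ℂ] H) B) ∘L (π.isUnitaryAction (x * y)).toCLM =
        ((ContinuousLinearMap.mul ℂ (H →L[ℂ] H)).flip A) ∘L
          (π.isUnitaryAction (x * y)).toCLM := by
      refine ContinuousLinearMap.ext_on hd ?_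
      rintro _ ⟨a, b, rfl⟩
      change B * π.action (x * y) (E.mul a b) = π.action (x * y) (E.mul a b) * A
      rw [π.action_mul, ← mul_assoc, (π.isUnitaryAction x).amplification_mul, mul_assoc,
        (π.isUnitaryAction y).amplification_mul, mul_assoc]
    exact DFunLike.congr_fun h c
  measurable A ξ η := by
    have _ := hE.isAlgebraic.separable
    obtain ⟨f, hf, hb⟩ := hE.isMeasurableField.exists_basis
    obtain ⟨h, hh⟩ := exists_isZeroPaddedBasis_nat (K := H)
    have key : ∀ x, ⟪η, (π.isUnitaryAction x).amplification A ξ⟫_ℂ = ∑' p : ℕ × ℕ,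
        ⟪η, π.action x (f p.1 x) (A (h p.2))⟫_ℂ * ⟪π.action x (f p.1 x) (h p.2), ξ⟫_ℂ :=
      fun x => ((π.isUnitaryAction x).hasSum_coefficients (hb x) hh
        ((π.isUnitaryAction x).amplification_mul A) η ξ).tsum_eq.symm
    rw [funext key]
    refine Measurable.tsum fun p => (π.measurable _ (hf p.1) _ _).mul ?_
    simp only [← inner_conj_symm (π.action _ _ _) ξ]
    exact Complex.continuous_conj.measurable.comp (π.measurable _ (hf p.1) _ _)

lemma e0Semigroup_map_mul_action (π : EssentialRep E H) (hE : E.IsProductSystem) {x : P}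
    (A : H →L[ℂ] H) (a : E.fiber x) :
    (π.e0Semigroup hE).map x A * π.action x a = π.action x a * A := by
  have _ := hE.isAlgebraic.separable x
  exact (π.isUnitaryAction x).amplification_mul A a

variable [Nontrivial H]

/-- The fibre `E(x)` embeds isometrically into the intertwining space. -/
noncomputable def toIntertwiner (π : EssentialRep E H) (hE : E.IsProductSystem) (x : P) :
    E.fiber x →ₗᵢ[ℂ] (π.e0Semigroup hE).intertwiner x where
  toFun a := ⟨π.action x a, fun A => π.e0Semigroup_map_mul_action hE A a⟩
  map_add' a b := Subtype.ext (map_add _ a b)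
  map_smul' c a := Subtype.ext (map_smul _ c a)
  norm_map' a := by
    obtain ⟨ξ, hξ⟩ := exists_ne (0 : H)
    refine le_antisymm ((π.action x a).opNorm_le_bound (norm_nonneg _)
      fun ζ => ((π.isUnitaryAction x).norm_apply a ζ).le) ?_
    have h := (π.action x a).le_opNorm ξ
    rw [(π.isUnitaryAction x).norm_apply] at h
    exact le_of_mul_le_mul_right h (norm_pos_iff.2 hξ)

lemma toIntertwiner_surjective (π : EssentialRep E H) (hE : E.IsProductSystem) (x : P) :
    Function.Surjective (π.toIntertwiner hE x) := by
  intro T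
  let θ := (π.toIntertwiner hE x).toContinuousLinearMap
  refine ⟨ContinuousLinearMap.adjoint θ T, ?_⟩
  -- the difference `D` is orthogonal to all `θ a`, hence its range to that of every `θ a`
  set D := T - θ (ContinuousLinearMap.adjoint θ T)
  have h1 : ∀ a, ⟪θ a, D⟫_ℂ = 0 := fun a => by
    rw [inner_sub_right, sub_eq_zero, ← ContinuousLinearMap.adjoint_inner_right]
    exact ((π.toIntertwiner hE x).inner_map_map _ _).symm
  have h2 : (D : H →L[ℂ] H) = 0 := by
    ext ξ
    refine (π.isUnitaryAction x).eq_zero_of_inner fun a ζ => ?_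
    have h3 : star ((θ a : (π.e0Semigroup hE).intertwiner x) : H →L[ℂ] H) * (D : H →L[ℂ] H) = 0 := by
      rw [(π.e0Semigroup hE).scalar_spec x (θ a) D]
      change ⟪θ a, D⟫_ℂ • (1 : H →L[ℂ] H) = 0
      rw [h1, zero_smul]
    have h4 : star (π.action x a) ((D : H →L[ℂ] H) ξ) = 0 := DFunLike.congr_fun h3 ξ
    rw [← ContinuousLinearMap.adjoint_inner_right, ← ContinuousLinearMap.star_eq_adjoint, h4,
      inner_zero_right]
  exact (sub_eq_zero.1 (Subtype.ext h2)).symm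

lemma isomorphic_productSystem (π : EssentialRep E H) (hE : E.IsProductSystem) :
    E.Isomorphic (π.e0Semigroup hE).productSystem :=
  ⟨fun x => LinearIsometryEquiv.ofSurjective (π.toIntertwiner hE x)
      (π.toIntertwiner_surjective hE x),
    fun _ _ a b => Subtype.ext (π.action_mul a b),
    fun s hs ξ η => π.measurable s hs ξ η⟩

theorem isConcrete (π : EssentialRep E H) (hE : E.IsProductSystem) : E.IsConcrete := by
  obtain ⟨f, hf⟩ := exists_isZeroPaddedBasis_nat (K := H)
  -- the index set of the Hilbert basis is a subtype of `ℕ`, so its `ℓ²` lies in `Type`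
  let U := hf.hilbertBasis.repr
  refine ⟨lp (fun _ : {i // f i ≠ 0} => ℂ) 2, inferInstance, inferInstance, inferInstance,
    U.symm.toEquiv.nontrivial, U.surjective.denseRange.separableSpace U.continuous, ?_⟩
  have _ : Nontrivial (lp (fun _ : {i // f i ≠ 0} => ℂ) 2) := U.symm.toEquiv.nontrivial
  have _ : TopologicalSpace.SeparableSpace (lp (fun _ : {i // f i ≠ 0} => ℂ) 2) :=
    U.surjective.denseRange.separableSpace U.continuous
  exact ⟨_, (π.transport U).isomorphic_productSystem hE⟩

end EssentialRep

/-! ### Isometric representations on pre-Hilbert spaces -/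

/-- A measurable isometric representation of a product system on a pre-Hilbert space. -/
structure IsometricRep {P : Type v} [Mul P] [MeasurableSpace P] (E : ProductSystemData.{u} P)
    (V : Type w) [SeminormedAddCommGroup V] [InnerProductSpace ℂ V] where
  /-- the action of a vector in `E(x)` -/
  action : ∀ x, E.fiber x →ₗ[ℂ] V →ₗ[ℂ] V
  inner_action : ∀ {x : P} (a b : E.fiber x) (ξ η : V),
    ⟪action x a ξ, action x b η⟫_ℂ = ⟪a, b⟫_ℂ * ⟪ξ, η⟫_ℂ
  action_mul : ∀ {x y : P} (a : E.fiber x) (b : E.fiber y) (ξ : V),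
    action (x * y) (E.mul a b) ξ = action x a (action y b ξ)
  measurable : ∀ s ∈ E.sections, ∀ ξ η : V, Measurable fun x => ⟪η, action x (s x) ξ⟫_ℂ

namespace IsometricRep

variable {P : Type v} [Mul P] [MeasurableSpace P] {E : ProductSystemData.{u} P}
  {V : Type w} [SeminormedAddCommGroup V] [InnerProductSpace ℂ V]

lemma norm_action (π : IsometricRep E V) {x : P} (a : E.fiber x) (ξ : V) :
    ‖π.action x a ξ‖ = ‖a‖ * ‖ξ‖ := by
  have h := π.inner_action a a ξ ξ
  simp only [inner_self_eq_norm_sq_to_K] at h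
  have h' : ‖π.action x a ξ‖ ^ 2 = (‖a‖ * ‖ξ‖) ^ 2 := by
    rw [mul_pow]
    exact_mod_cast h
  exact (sq_eq_sq₀ (norm_nonneg _) (by positivity)).1 h'

/-- The span of the vectors `a ξ` with `a ∈ E(x)`. -/
def range (π : IsometricRep E V) (x : P) : Submodule ℂ V :=
  Submodule.span ℂ {ζ | ∃ a ξ, ζ = π.action x a ξ}

/-- The action of a vector as a bounded operator. -/
noncomputable def actionCLM (π : IsometricRep E V) {x : P} (a : E.fiber x) : V →L[ℂ] V :=
  (π.action x a).mkContinuous ‖a‖ fun ξ => (π.norm_action a ξ).le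

lemma actionCLM_apply (π : IsometricRep E V) {x : P} (a : E.fiber x) (ξ : V) :
    π.actionCLM a ξ = π.action x a ξ := rfl

open UniformSpace in
/-- A representation on a pre-Hilbert space that is essential up to closure extends to an essential
representation on the completion. -/
noncomputable def completion (π : IsometricRep E V) (hd : ∀ x, Dense (π.range x : Set V)) :
    EssentialRep E (Completion V) where
  action x :=
    { toFun := fun a => (π.actionCLM a).completion
      map_add' := fun a b => by
        refine ContinuousLinearMap.ext fun ξ => Completion.induction_on ξ (isClosed_eq
          (ContinuousLinearMap.continuous _) (ContinuousLinearMap.continuous _)) fun ξ => ?_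
        change _ = (π.actionCLM a).completion (ξ : Completion V) + (π.actionCLM b).completion ξ
        simp only [ContinuousLinearMap.completion_apply_coe, actionCLM_apply, map_add,
          LinearMap.add_apply, Completion.coe_add]
      map_smul' := fun c a => by
        refine ContinuousLinearMap.ext fun ξ => Completion.induction_on ξ (isClosed_eq
          (ContinuousLinearMap.continuous _) (ContinuousLinearMap.continuous _)) fun ξ => ?_
        change _ = c • (π.actionCLM a).completion (ξ : Completion V)
        simp only [ContinuousLinearMap.completion_apply_coe, actionCLM_apply, map_smul,
          LinearMap.smul_apply, Completion.coe_smul] }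
  isUnitaryAction x :=
    { inner_apply := fun a b ξ η => by
        change ⟪(π.actionCLM a).completion ξ, (π.actionCLM b).completion η⟫_ℂ = _
        induction ξ, η using Completion.induction_on₂ with
        | hp => exact isClosed_eq (by fun_prop) (by fun_prop)
        | ih ξ η =>
          simp only [ContinuousLinearMap.completion_apply_coe, Completion.inner_coe,
            actionCLM_apply, π.inner_action]
      dense_span := by
        have h := Completion.denseRange_coe.dense_image (Completion.continuous_coe V) (hd x)
        refine h.mono ?_
        rintro _ ⟨ζ, hζ, rfl⟩
        have hle : π.range x ≤ Submodule.comap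
            (Completion.toComplL (𝕜 := ℂ) : V →L[ℂ] Completion V).toLinearMap
            (Submodule.span ℂ {ζ | ∃ a ξ, ζ = (π.actionCLM (x := x) a).completion ξ}) := by
          refine Submodule.span_le.2 ?_
          rintro _ ⟨a, ξ, rfl⟩
          exact Submodule.subset_span
            ⟨a, (ξ : Completion V), ((π.actionCLM a).completion_apply_coe ξ).symm⟩
        exact hle hζ }
  action_mul a b := by
    ext ξ
    change (π.actionCLM (E.mul a b)).completion ξ =
      (π.actionCLM a).completion ((π.actionCLM b).completion ξ)
    induction ξ using Completion.induction_on with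
    | hp => exact isClosed_eq (by fun_prop) (by fun_prop)
    | ih ξ => simp only [ContinuousLinearMap.completion_apply_coe, actionCLM_apply, π.action_mul]
  measurable s hs ξ η := by
    -- approximate `ξ` and `η` by sequences in `V`
    obtain ⟨p, hp, hξ⟩ := mem_closure_iff_seq_limit.1 (Completion.denseRange_coe ξ)
    obtain ⟨q, hq, hη⟩ := mem_closure_iff_seq_limit.1 (Completion.denseRange_coe η)
    choose p' hp' using hp
    choose q' hq' using hq
    refine measurable_of_tendsto_metrizable (fun n => π.measurable s hs (p' n) (q' n))
      (tendsto_pi_nhds.2 fun x => ?_)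
    refine (hη.inner (((π.actionCLM (s x)).completion.continuous.tendsto ξ).comp hξ)).congr
      fun n => ?_
    simp only [Function.comp_apply]
    rw [← hp', ← hq', ContinuousLinearMap.completion_apply_coe, Completion.inner_coe,
      actionCLM_apply]

end IsometricRep

/-! ### Inductive limit along an isometry -/

section StableSeq

variable {V : Type w} [SeminormedAddCommGroup V] [InnerProductSpace ℂ V]

/-- The sequences with `ξ (n + 1) = R (ξ n)` for large `n`. -/
def stableSubmodule (R : V →ₗᵢ[ℂ] V) : Submodule ℂ (ℕ → V) where
  carrier := {ξ | ∃ N, ∀ n ≥ N, ξ (n + 1) = R (ξ n)}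
  zero_mem' := ⟨0, fun n _ => by simp⟩
  add_mem' := by
    rintro ξ η ⟨N, hN⟩ ⟨M, hM⟩
    refine ⟨max N M, fun n hn => ?_⟩
    simp [hN n (le_of_max_le_left hn), hM n (le_of_max_le_right hn)]
  smul_mem' := by
    rintro c ξ ⟨N, hN⟩
    exact ⟨N, fun n hn => by simp [hN n hn]⟩

/-- The inductive limit of `V → V → V → ⋯` along an isometry `R`, as a pre-Hilbert space: sequences
that are eventually `R`-orbits, with the eventual value of `⟪ξ n, η n⟫` as inner product. -/
def StableSeq (R : V →ₗᵢ[ℂ] V) : Type w := stableSubmodule R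

namespace StableSeq

variable {R : V →ₗᵢ[ℂ] V}

noncomputable instance : AddCommGroup (StableSeq R) :=
  inferInstanceAs (AddCommGroup (stableSubmodule R))

noncomputable instance : Module ℂ (StableSeq R) :=
  inferInstanceAs (Module ℂ (stableSubmodule R))

/-- The entries of a stable sequence. -/
def entry (n : ℕ) : StableSeq R →ₗ[ℂ] V where
  toFun ξ := ξ.1 n
  map_add' _ _ := rfl
  map_smul' _ _ := rfl

/-- The stable sequence with given entries. -/
def mk (f : ℕ → V) (h : ∃ N, ∀ n ≥ N, f (n + 1) = R (f n)) : StableSeq R := ⟨f, h⟩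

@[simp] lemma entry_mk (f : ℕ → V) (h : ∃ N, ∀ n ≥ N, f (n + 1) = R (f n)) (n : ℕ) :
    entry n (mk f h) = f n := rfl

@[ext] lemma ext {ξ η : StableSeq R} (h : ∀ n, entry n ξ = entry n η) : ξ = η :=
  Subtype.ext (funext h)

/-- The sequence follows the recursion from index `N` on. -/
def IsStableFrom (ξ : StableSeq R) (N : ℕ) : Prop := ∀ n ≥ N, entry (n + 1) ξ = R (entry n ξ)

lemma exists_isStableFrom (ξ : StableSeq R) : ∃ N, ξ.IsStableFrom N := ξ.2

lemma IsStableFrom.mono {ξ : StableSeq R} {N M : ℕ} (h : ξ.IsStableFrom N) (hNM : N ≤ M) :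
    ξ.IsStableFrom M := fun n hn => h n (hNM.trans hn)

lemma exists_isStableFrom₂ (ξ η : StableSeq R) : ∃ N, ξ.IsStableFrom N ∧ η.IsStableFrom N := by
  obtain ⟨N, hN⟩ := ξ.exists_isStableFrom
  obtain ⟨M, hM⟩ := η.exists_isStableFrom
  exact ⟨max N M, hN.mono (le_max_left _ _), hM.mono (le_max_right _ _)⟩

lemma IsStableFrom.inner_entry {ξ η : StableSeq R} {N : ℕ} (hξ : ξ.IsStableFrom N)
    (hη : η.IsStableFrom N) {n : ℕ} (hn : N ≤ n) :
    ⟪entry n ξ, entry n η⟫_ℂ = ⟪entry N ξ, entry N η⟫_ℂ := by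
  induction n, hn using Nat.le_induction with
  | base => rfl
  | succ n hn ih => rw [hξ n hn, hη n hn, R.inner_map_map, ih]

noncomputable instance : Inner ℂ (StableSeq R) where
  inner ξ η := Filter.atTop.limUnder fun n => ⟪entry n ξ, entry n η⟫_ℂ

lemma IsStableFrom.inner_eq {ξ η : StableSeq R} {N : ℕ} (hξ : ξ.IsStableFrom N)
    (hη : η.IsStableFrom N) : ⟪ξ, η⟫_ℂ = ⟪entry N ξ, entry N η⟫_ℂ := by
  refine Filter.Tendsto.limUnder_eq ((tendsto_const_nhds).congr' ?_)
  filter_upwards [Filter.eventually_ge_atTop N] with n hn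
  exact (hξ.inner_entry hη hn).symm

lemma IsStableFrom.add {ξ η : StableSeq R} {N : ℕ} (hξ : ξ.IsStableFrom N)
    (hη : η.IsStableFrom N) : (ξ + η).IsStableFrom N := fun n hn => by
  simp [hξ n hn, hη n hn]

lemma IsStableFrom.smul {ξ : StableSeq R} {N : ℕ} (c : ℂ) (hξ : ξ.IsStableFrom N) :
    (c • ξ).IsStableFrom N := fun n hn => by
  simp [hξ n hn]

/-- The semi-inner product on stable sequences. -/
@[reducible]
noncomputable def core : PreInnerProductSpace.Core ℂ (StableSeq R) where
  conj_inner_symm ξ η := by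
    obtain ⟨N, h1, h2⟩ := exists_isStableFrom₂ ξ η
    rw [h1.inner_eq h2, h2.inner_eq h1, inner_conj_symm]
  re_inner_nonneg ξ := by
    obtain ⟨N, h⟩ := ξ.exists_isStableFrom
    rw [h.inner_eq h]
    exact inner_self_nonneg
  add_left ξ η ζ := by
    obtain ⟨N, h1, h2⟩ := exists_isStableFrom₂ ξ η
    obtain ⟨M, h3⟩ := ζ.exists_isStableFrom
    replace h1 := h1.mono (le_max_left N M)
    replace h2 := h2.mono (le_max_left N M)
    replace h3 := h3.mono (le_max_right N M)
    rw [(h1.add h2).inner_eq h3, h1.inner_eq h3, h2.inner_eq h3, map_add, inner_add_left]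
  smul_left ξ η c := by
    obtain ⟨N, h1, h2⟩ := exists_isStableFrom₂ ξ η
    rw [(h1.smul c).inner_eq h2, h1.inner_eq h2, map_smul, inner_smul_left]

noncomputable instance : SeminormedAddCommGroup (StableSeq R) :=
  @InnerProductSpace.Core.toSeminormedAddCommGroup ℂ _ _ _ _ (core (R := R))

noncomputable instance : InnerProductSpace ℂ (StableSeq R) :=
  InnerProductSpace.ofCore core

lemma IsStableFrom.norm_eq {ξ : StableSeq R} {N : ℕ} (h : ξ.IsStableFrom N) :
    ‖ξ‖ = ‖entry N ξ‖ := by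
  have h1 := congrArg RCLike.re (h.inner_eq h)
  rw [inner_self_eq_norm_sq, inner_self_eq_norm_sq] at h1
  exact (sq_eq_sq₀ (norm_nonneg _) (norm_nonneg _)).1 h1

/-- The embedding of the `n`-th copy of `V`. -/
noncomputable def embed (R : V →ₗᵢ[ℂ] V) (n : ℕ) : V →ₗ[ℂ] StableSeq R where
  toFun v := mk (fun m => if m < n then 0 else (R.toLinearMap ^ (m - n)) v) ⟨n, fun m hm => by
    have h1 : ¬ m + 1 < n := by omega
    have h2 : ¬ m < n := by omega
    rw [if_neg h1, if_neg h2, Nat.sub_add_comm hm, pow_succ']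
    rfl⟩
  map_add' v w := by
    ext m
    rw [map_add]
    by_cases h : m < n <;> simp [h]
  map_smul' c v := by
    ext m
    rw [map_smul]
    by_cases h : m < n <;> simp [h]

lemma entry_embed (n : ℕ) (v : V) (m : ℕ) :
    entry m (embed R n v) = if m < n then 0 else (R.toLinearMap ^ (m - n)) v := rfl

lemma isStableFrom_embed (n : ℕ) (v : V) : (embed R n v).IsStableFrom n := (embed R n v).2.elim
  fun _ _ m hm => by
    have h1 : ¬ m + 1 < n := by omega
    have h2 : ¬ m < n := by omega
    rw [entry_embed, entry_embed, if_neg h1, if_neg h2, Nat.sub_add_comm hm, pow_succ']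
    rfl

lemma norm_embed (n : ℕ) (v : V) : ‖embed R n v‖ = ‖v‖ := by
  rw [(isStableFrom_embed n v).norm_eq, entry_embed]
  simp

lemma IsStableFrom.norm_sub_embed {ξ : StableSeq R} {N : ℕ} (h : ξ.IsStableFrom N) :
    ‖ξ - embed R N (entry N ξ)‖ = 0 := by
  have h1 := h.add ((isStableFrom_embed N (entry N ξ)).smul (-1))
  rw [neg_one_smul, ← sub_eq_add_neg] at h1
  rw [h1.norm_eq, map_sub, entry_embed]
  simp

lemma norm_embed_sub_embed (n k : ℕ) (v : V) :
    ‖embed R n v - embed R (n + k) ((R.toLinearMap ^ k) v)‖ = 0 := by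
  have h := ((isStableFrom_embed (R := R) n v).mono (Nat.le_add_right n k)).norm_sub_embed
  rw [entry_embed (n := n)] at h
  simpa using h

instance [TopologicalSpace.SeparableSpace V] : TopologicalSpace.SeparableSpace (StableSeq R) := by
  refine ⟨⋃ n, Set.range fun k => embed R n (TopologicalSpace.denseSeq V k),
    Set.countable_iUnion fun n => Set.countable_range _, ?_⟩
  refine Metric.dense_iff.2 fun ξ ε hε => ?_
  obtain ⟨N, h⟩ := ξ.exists_isStableFrom
  obtain ⟨k, hk⟩ := (TopologicalSpace.denseRange_denseSeq V).exists_dist_lt (entry N ξ) hε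
  refine ⟨embed R N (TopologicalSpace.denseSeq V k), ?_, Set.mem_iUnion.2 ⟨N, k, rfl⟩⟩
  rw [Metric.mem_ball', dist_eq_norm]
  calc _ ≤ ‖ξ - embed R N (entry N ξ)‖ +
        ‖embed R N (entry N ξ) - embed R N (TopologicalSpace.denseSeq V k)‖ :=
      norm_sub_le_norm_sub_add_norm_sub _ _ _
    _ < ε := by rwa [h.norm_sub_embed, ← map_sub, norm_embed, zero_add, ← dist_eq_norm]

/-- The entrywise action of an operator that commutes with `R`. -/
noncomputable def map (T : V →ₗ[ℂ] V) (hT : ∀ v, R (T v) = T (R v)) :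
    StableSeq R →ₗ[ℂ] StableSeq R where
  toFun ξ := mk (fun n => T (entry n ξ))
    (ξ.exists_isStableFrom.imp fun N hN n hn => by rw [hN n hn, hT])
  map_add' ξ η := by
    ext n
    rw [map_add]
    simp only [entry_mk, map_add]
  map_smul' c ξ := by
    ext n
    rw [map_smul]
    simp only [entry_mk, map_smul, RingHom.id_apply]

lemma entry_map (T : V →ₗ[ℂ] V) (hT : ∀ v, R (T v) = T (R v)) (ξ : StableSeq R) (n : ℕ) :
    entry n (map T hT ξ) = T (entry n ξ) := rfl

lemma IsStableFrom.map {T : V →ₗ[ℂ] V} (hT : ∀ v, R (T v) = T (R v)) {ξ : StableSeq R} {N : ℕ}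
    (h : ξ.IsStableFrom N) : (map T hT ξ).IsStableFrom N := fun n hn => by
  rw [entry_map, entry_map, h n hn, hT]

end StableSeq

namespace IsometricRep

variable {P : Type v} [Mul P] [MeasurableSpace P] {E : ProductSystemData.{u} P}

/-- A representation in the commutant of `R` acts entrywise on the inductive limit along `R`. -/
noncomputable def stableSeq (π : IsometricRep E V) (R : V →ₗᵢ[ℂ] V)
    (hR : ∀ (x : P) (a : E.fiber x) (ξ : V), R (π.action x a ξ) = π.action x a (R ξ)) :
    IsometricRep E (StableSeq R) where
  action x :=
    { toFun := fun a => StableSeq.map (π.action x a) (hR x a)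
      map_add' := fun a b => LinearMap.ext fun ξ => StableSeq.ext fun n => by
        rw [LinearMap.add_apply, map_add (StableSeq.entry n)]
        simp only [StableSeq.entry_map, map_add, LinearMap.add_apply]
      map_smul' := fun c a => LinearMap.ext fun ξ => StableSeq.ext fun n => by
        rw [LinearMap.smul_apply, map_smul (StableSeq.entry n)]
        simp only [StableSeq.entry_map, map_smul, LinearMap.smul_apply, RingHom.id_apply] }
  inner_action {x} a b ξ η := by
    obtain ⟨N, h1, h2⟩ := StableSeq.exists_isStableFrom₂ ξ η
    rw [h1.inner_eq h2, ← π.inner_action]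
    exact (h1.map (hR x a)).inner_eq (h2.map (hR x b))
  action_mul a b ξ := StableSeq.ext fun n => π.action_mul a b _
  measurable s hs ξ η := by
    obtain ⟨N, h1, h2⟩ := StableSeq.exists_isStableFrom₂ ξ η
    have h := fun x => h2.inner_eq (h1.map (hR x (s x)))
    exact (funext h) ▸ π.measurable s hs (StableSeq.entry N ξ) (StableSeq.entry N η)

variable (π : IsometricRep E V) (R : V →ₗᵢ[ℂ] V)
    (hR : ∀ (x : P) (a : E.fiber x) (ξ : V), R (π.action x a ξ) = π.action x a (R ξ))

lemma stableSeq_action_embed {x : P} (a : E.fiber x) (n : ℕ) (v : V) :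
    (π.stableSeq R hR).action x a (StableSeq.embed R n v) =
      StableSeq.embed R n (π.action x a v) := by
  have h : ∀ k (v : V), π.action x a ((R.toLinearMap ^ k) v) =
      (R.toLinearMap ^ k) (π.action x a v) := fun k => by
    induction k with
    | zero => exact fun v => rfl
    | succ k ih =>
      intro v
      rw [pow_succ, Module.End.mul_apply, ih, Module.End.mul_apply]
      exact congrArg _ (hR x a v).symm
  refine StableSeq.ext fun m => ?_
  change π.action x a (StableSeq.entry m (StableSeq.embed R n v)) = _
  rw [StableSeq.entry_embed, StableSeq.entry_embed]
  split_ifs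
  · exact map_zero _
  · exact h _ _

/-- The representation on the inductive limit is essential if every vector is moved by the powers
of `R` arbitrarily close to each of the ranges. -/
lemma dense_range_stableSeq
    (h : ∀ (x : P) (v : V), ∀ ε > 0, ∃ k, ∃ w ∈ π.range x, ‖(R.toLinearMap ^ k) v - w‖ < ε)
    (x : P) :
    Dense ((π.stableSeq R hR).range x : Set (StableSeq R)) := by
  refine Metric.dense_iff.2 fun ξ ε hε => ?_
  obtain ⟨N, hN⟩ := ξ.exists_isStableFrom
  obtain ⟨k, w, hw, hlt⟩ := h x (StableSeq.entry N ξ) ε hε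
  refine ⟨StableSeq.embed R (N + k) w, ?_, ?_⟩
  · rw [Metric.mem_ball', dist_eq_norm]
    calc _ ≤ ‖ξ - StableSeq.embed R N (StableSeq.entry N ξ)‖ +
          ‖StableSeq.embed R N (StableSeq.entry N ξ) - StableSeq.embed R (N + k) w‖ :=
        norm_sub_le_norm_sub_add_norm_sub _ _ _
      _ ≤ ‖ξ - StableSeq.embed R N (StableSeq.entry N ξ)‖ +
          (‖StableSeq.embed R N (StableSeq.entry N ξ) -
            StableSeq.embed R (N + k) ((R.toLinearMap ^ k) (StableSeq.entry N ξ))‖ +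
          ‖StableSeq.embed R (N + k) ((R.toLinearMap ^ k) (StableSeq.entry N ξ)) -
            StableSeq.embed R (N + k) w‖) :=
        add_le_add_right (norm_sub_le_norm_sub_add_norm_sub _ _ _) _
      _ < ε := by
        rwa [hN.norm_sub_embed, StableSeq.norm_embed_sub_embed, ← map_sub, StableSeq.norm_embed,
          zero_add, zero_add]
  · refine (Submodule.span_le.2 ?_ : π.range x ≤
      ((π.stableSeq R hR).range x).comap (StableSeq.embed R (N + k))) hw
    rintro _ ⟨a, v, rfl⟩
    exact Submodule.subset_span ⟨a, _, (π.stableSeq_action_embed R hR a (N + k) v).symm⟩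

end IsometricRep

end StableSeq

/-! ### Square-integrable sections -/

section L2Sections

variable {P : Type v} [MeasurableSpace P] [Mul P] {E : ProductSystemData.{u} P}

lemma ProductSystemData.IsMeasurableField.integrable_inner (hE : E.IsMeasurableField)
    {μ : Measure P} {f g : ∀ x, E.fiber x} (hf : f ∈ E.sections) (hg : g ∈ E.sections)
    (hfi : Integrable (fun x => ‖f x‖ ^ 2) μ) (hgi : Integrable (fun x => ‖g x‖ ^ 2) μ) :
    Integrable (fun x => ⟪f x, g x⟫_ℂ) μ := by
  refine (hfi.add hgi).mono' (hE.measurable_inner f hf g hg).aestronglyMeasurable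
    (Filter.Eventually.of_forall fun x => ?_)
  have h := norm_inner_le_norm (𝕜 := ℂ) (f x) (g x)
  simp only [Pi.add_apply]
  nlinarith [sq_nonneg (‖f x‖ - ‖g x‖), sq_nonneg (‖f x‖ + ‖g x‖)]

/-- The measurable sections with square-integrable norm. -/
def l2Submodule (hE : E.IsMeasurableField) (μ : Measure P) : Submodule ℂ (∀ x, E.fiber x) where
  carrier := {f | f ∈ E.sections ∧ Integrable (fun x => ‖f x‖ ^ 2) μ}
  zero_mem' := ⟨hE.zero_mem, by simp⟩
  add_mem' := by
    rintro f g ⟨hf, hfi⟩ ⟨hg, hgi⟩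
    refine ⟨hE.add_mem hf hg, ((hfi.add hgi).const_mul 2).mono'
      (hE.measurable_norm_sq (hE.add_mem hf hg)).aestronglyMeasurable
      (Filter.Eventually.of_forall fun x => ?_)⟩
    have h := norm_add_le (f x) (g x)
    simp only [Pi.add_apply, Real.norm_eq_abs, abs_sq]
    nlinarith [sq_nonneg (‖f x‖ - ‖g x‖), norm_nonneg (f x + g x)]
  smul_mem' := by
    rintro c f ⟨hf, hfi⟩
    refine ⟨hE.const_smul_mem c hf, ?_⟩
    simp only [Pi.smul_apply, norm_smul, mul_pow]
    exact hfi.const_mul _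

/-- The square-integrable measurable sections of a product system as a pre-Hilbert space; sections
that agree almost everywhere are not identified. -/
def L2Sections (hE : E.IsMeasurableField) (μ : Measure P) : Type (max u v) := l2Submodule hE μ

namespace L2Sections

variable {hE : E.IsMeasurableField} {μ : Measure P}

noncomputable instance : AddCommGroup (L2Sections hE μ) :=
  inferInstanceAs (AddCommGroup (l2Submodule hE μ))

noncomputable instance : Module ℂ (L2Sections hE μ) :=
  inferInstanceAs (Module ℂ (l2Submodule hE μ))

/-- The underlying section. -/
def toSection : L2Sections hE μ →ₗ[ℂ] ∀ x, E.fiber x where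
  toFun f := f.1
  map_add' _ _ := rfl
  map_smul' _ _ := rfl

/-- The element given by a square-integrable section. -/
def mk (f : ∀ x, E.fiber x) (hf : f ∈ E.sections) (hfi : Integrable (fun x => ‖f x‖ ^ 2) μ) :
    L2Sections hE μ := ⟨f, hf, hfi⟩

@[simp] lemma toSection_mk (f : ∀ x, E.fiber x) (hf : f ∈ E.sections)
    (hfi : Integrable (fun x => ‖f x‖ ^ 2) μ) : toSection (mk (hE := hE) f hf hfi) = f := rfl

lemma ext {f g : L2Sections hE μ} (h : ∀ x, toSection f x = toSection g x) : f = g :=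
  Subtype.ext (funext h)

lemma mem_sections (f : L2Sections hE μ) : toSection f ∈ E.sections := f.2.1

lemma integrable (f : L2Sections hE μ) : Integrable (fun x => ‖toSection f x‖ ^ 2) μ := f.2.2

noncomputable instance : Inner ℂ (L2Sections hE μ) where
  inner f g := ∫ x, ⟪toSection f x, toSection g x⟫_ℂ ∂μ

lemma inner_def (f g : L2Sections hE μ) :
    ⟪f, g⟫_ℂ = ∫ x, ⟪toSection f x, toSection g x⟫_ℂ ∂μ := rfl

lemma integrable_inner (f g : L2Sections hE μ) :
    Integrable (fun x => ⟪toSection f x, toSection g x⟫_ℂ) μ :=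
  hE.integrable_inner f.mem_sections g.mem_sections f.integrable g.integrable

lemma inner_self_eq (f : L2Sections hE μ) : ⟪f, f⟫_ℂ = ((∫ x, ‖toSection f x‖ ^ 2 ∂μ : ℝ) : ℂ) := by
  rw [inner_def, ← integral_complex_ofReal]
  refine integral_congr_ae (Filter.Eventually.of_forall fun x => ?_)
  change ⟪toSection f x, toSection f x⟫_ℂ = _
  rw [inner_self_eq_norm_sq_to_K]
  simp

/-- The semi-inner product on square-integrable sections. -/
@[reducible]
noncomputable def core : PreInnerProductSpace.Core ℂ (L2Sections hE μ) where
  conj_inner_symm f g := by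
    rw [inner_def, inner_def, ← integral_conj]
    simp only [inner_conj_symm]
  re_inner_nonneg f := by
    rw [inner_self_eq]
    exact integral_nonneg fun x => by positivity
  add_left f g h := by
    rw [inner_def, inner_def, inner_def, ← integral_add (integrable_inner f h)
      (integrable_inner g h), map_add]
    simp only [Pi.add_apply, inner_add_left]
  smul_left f g c := by
    rw [inner_def, inner_def, ← integral_const_mul, map_smul]
    simp only [Pi.smul_apply, inner_smul_left]

noncomputable instance : SeminormedAddCommGroup (L2Sections hE μ) :=
  @InnerProductSpace.Core.toSeminormedAddCommGroup ℂ _ _ _ _ core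

noncomputable instance : InnerProductSpace ℂ (L2Sections hE μ) := InnerProductSpace.ofCore core

lemma norm_sq_eq (f : L2Sections hE μ) : ‖f‖ ^ 2 = ∫ x, ‖toSection f x‖ ^ 2 ∂μ := by
  have h := inner_self_eq f
  rw [inner_self_eq_norm_sq_to_K] at h
  exact Complex.ofReal_injective ((Complex.ofReal_pow _ _).trans h)

open Classical in
/-- Restriction of a section to a measurable set. -/
noncomputable def restrict (f : L2Sections hE μ) {A : Set P} (hA : MeasurableSet A) :
    L2Sections hE μ :=
  mk (fun x => if x ∈ A then toSection f x else 0) (hE.piecewise_mem hA f.mem_sections) <| by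
    refine (f.integrable.indicator hA).congr (Filter.Eventually.of_forall fun x => ?_)
    by_cases hx : x ∈ A <;> simp [hx]

lemma restrict_apply_of_mem (f : L2Sections hE μ) {A : Set P} (hA : MeasurableSet A) {x : P}
    (hx : x ∈ A) : toSection (f.restrict hA) x = toSection f x := if_pos hx

lemma restrict_apply_of_notMem (f : L2Sections hE μ) {A : Set P} (hA : MeasurableSet A) {x : P}
    (hx : x ∉ A) : toSection (f.restrict hA) x = 0 := if_neg hx

lemma norm_sub_restrict_sq (f : L2Sections hE μ) {A : Set P} (hA : MeasurableSet A) :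
    ‖f - f.restrict hA‖ ^ 2 = ∫ x in Aᶜ, ‖toSection f x‖ ^ 2 ∂μ := by
  rw [norm_sq_eq, ← integral_indicator hA.compl]
  refine integral_congr_ae (Filter.Eventually.of_forall fun x => ?_)
  change ‖toSection (f - f.restrict hA) x‖ ^ 2 = _
  rw [map_sub, Pi.sub_apply]
  by_cases hx : x ∈ A
  · simp [hx, f.restrict_apply_of_mem hA hx]
  · simp [hx, f.restrict_apply_of_notMem hA hx]

/-- Sections are approximated by their restrictions to an increasing exhaustion. -/
lemma exists_norm_sub_restrict_lt (f : L2Sections hE μ) {A : ℕ → Set P}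
    (hA : ∀ n, MeasurableSet (A n)) (hmono : Monotone A) (hun : ∀ x, ∃ n, x ∈ A n) {ε : ℝ}
    (hε : 0 < ε) : ∃ n, ‖f - f.restrict (hA n)‖ < ε := by
  have h := tendsto_setIntegral_of_antitone (μ := μ) (f := fun x => ‖toSection f x‖ ^ 2)
    (fun n => (hA n).compl) (fun m n hmn => Set.compl_subset_compl.2 (hmono hmn))
    ⟨0, f.integrable.integrableOn⟩
  have h0 : ⋂ n, (A n)ᶜ = ∅ := by
    rw [← Set.compl_iUnion, Set.compl_empty_iff, Set.iUnion_eq_univ_iff]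
    exact hun
  rw [h0, Measure.restrict_empty, integral_zero_measure] at h
  obtain ⟨n, hn⟩ := (h.eventually (gt_mem_nhds (pow_pos hε 2))).exists
  refine ⟨n, ?_⟩
  rw [← norm_sub_restrict_sq f (hA n)] at hn
  exact lt_of_pow_lt_pow_left₀ 2 hε.le hn

/-- The coefficients of a section with respect to a measurable field of zero-padded bases. -/
lemma memLp_coefficients [SFinite μ] {b : ℕ → ∀ x, E.fiber x} (hb : ∀ n, b n ∈ E.sections)
    (hbasis : ∀ x, IsZeroPaddedBasis fun n => b n x) (f : L2Sections hE μ) :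
    AEStronglyMeasurable (fun p : P × ℕ => ⟪b p.2 p.1, toSection f p.1⟫_ℂ) (μ.prod Measure.count) ∧
    eLpNorm (fun p : P × ℕ => ⟪b p.2 p.1, toSection f p.1⟫_ℂ) 2 (μ.prod Measure.count) =
      ENNReal.ofReal ‖f‖ := by
  have hm : Measurable fun p : P × ℕ => ⟪b p.2 p.1, toSection f p.1⟫_ℂ :=
    measurable_from_prod_countable_left fun n => hE.measurable_inner _ (hb n) _ f.mem_sections
  refine ⟨hm.aestronglyMeasurable, ?_⟩
  have h1 : ∀ x, ∑' n, ‖⟪b n x, toSection f x⟫_ℂ‖ₑ ^ 2 = ENNReal.ofReal (‖toSection f x‖ ^ 2) := by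
    intro x
    have h2 := (hbasis x).hasSum_inner_mul_inner (toSection f x) (toSection f x)
    have h3 : HasSum (fun n => ‖⟪b n x, toSection f x⟫_ℂ‖ ^ 2) (‖toSection f x‖ ^ 2) := by
      rw [inner_self_eq_norm_sq_to_K] at h2
      have h4 : ∀ n, ⟪toSection f x, b n x⟫_ℂ * ⟪b n x, toSection f x⟫_ℂ =
          ((‖⟪b n x, toSection f x⟫_ℂ‖ ^ 2 : ℝ) : ℂ) := fun n => by
        rw [← inner_conj_symm (toSection f x) (b n x), RCLike.conj_mul]
        simp
      simp only [h4] at h2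
      exact Complex.hasSum_ofReal.1 (by rwa [Complex.ofReal_pow])
    rw [← h3.tsum_eq, ENNReal.ofReal_tsum_of_nonneg (fun n => by positivity) h3.summable]
    refine tsum_congr fun n => ?_
    rw [ENNReal.ofReal_pow (norm_nonneg _), ofReal_norm]
  rw [eLpNorm_eq_lintegral_rpow_enorm_toReal (by norm_num) (by norm_num)]
  simp only [ENNReal.toReal_ofNat, ENNReal.rpow_ofNat]
  rw [lintegral_prod _ (hm.enorm.pow_const 2).aemeasurable]
  simp only [lintegral_count, h1]
  rw [← ofReal_integral_eq_lintegral_ofReal f.integrable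
    (Filter.Eventually.of_forall fun x => by positivity), ← norm_sq_eq,
    ENNReal.ofReal_rpow_of_nonneg (by positivity) (by norm_num)]
  congr 1
  rw [← Real.sqrt_eq_rpow, Real.sqrt_sq (norm_nonneg _)]

instance [MeasurableSpace.CountablyGenerated P] [SFinite μ] :
    TopologicalSpace.SeparableSpace (L2Sections hE μ) := by
  obtain ⟨b, hb, hbasis⟩ := hE.exists_basis
  have hLp : ∀ f : L2Sections hE μ, MemLp (fun p : P × ℕ => ⟪b p.2 p.1, toSection f p.1⟫_ℂ) 2
      (μ.prod Measure.count) := fun f =>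
    ⟨(memLp_coefficients hb hbasis f).1, by
      rw [(memLp_coefficients hb hbasis f).2]
      exact ENNReal.ofReal_lt_top⟩
  let F : L2Sections hE μ →ₗᵢ[ℂ] Lp ℂ 2 (μ.prod (Measure.count : Measure ℕ)) :=
    { toFun := fun f => (hLp f).toLp
      map_add' := fun f g => by
        rw [← MemLp.toLp_add]
        congr 1
        funext p
        simp only [map_add, Pi.add_apply, inner_add_right]
      map_smul' := fun c f => by
        rw [RingHom.id_apply, ← MemLp.toLp_const_smul]
        congr 1
        funext p
        simp only [map_smul, Pi.smul_apply, inner_smul_right, smul_eq_mul]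
      norm_map' := fun f => by
        change ‖(hLp f).toLp‖ = _
        rw [Lp.norm_toLp, (memLp_coefficients hb hbasis f).2, ENNReal.toReal_ofReal (norm_nonneg _)] }
  have _ : Fact ((2 : ENNReal) ≠ ⊤) := ⟨by norm_num⟩
  have _ := F.isometry.isUniformInducing.isInducing.secondCountableTopology
  infer_instance

lemma exists_norm_ne_zero [SigmaFinite μ] (hμ : μ ≠ 0) (hnt : ∀ x, Nontrivial (E.fiber x)) :
    ∃ f : L2Sections hE μ, ‖f‖ ≠ 0 := by
  classical
  by_contra! h
  obtain ⟨b, hb, hbasis⟩ := hE.exists_basis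
  have h1 : ∀ n k, ∀ᵐ x ∂μ, x ∈ spanningSets μ k → b n x = 0 := by
    intro n k
    have hA := measurableSet_spanningSets μ k
    have hs := hE.piecewise_mem hA (hb n)
    have hi : Integrable (fun x => ‖(if x ∈ spanningSets μ k then b n x else 0 : E.fiber x)‖ ^ 2) μ := by
      refine Integrable.mono' (g := (spanningSets μ k).indicator fun _ => (1 : ℝ))
        ((integrable_indicator_iff hA).2 (integrableOn_const (measure_spanningSets_lt_top μ k).ne))
        (hE.measurable_norm_sq hs).aestronglyMeasurable (Filter.Eventually.of_forall fun x => ?_)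
      by_cases hx : x ∈ spanningSets μ k
      · rcases (hbasis x).eq_zero_or_norm n with h0 | h0 <;> simp [hx, h0]
      · simp [hx]
    have h2 := norm_sq_eq (mk (hE := hE) _ hs hi)
    rw [h, zero_pow two_ne_zero, eq_comm, toSection_mk,
      integral_eq_zero_iff_of_nonneg (fun x => by positivity) hi] at h2
    filter_upwards [h2] with x hx hxk
    simpa [hxk] using hx
  have h2 : ∀ᵐ x ∂μ, ∀ n k, x ∈ spanningSets μ k → b n x = 0 :=
    ae_all_iff.2 fun n => ae_all_iff.2 fun k => h1 n k
  have _ : (ae μ).NeBot := ae_neBot.2 hμ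
  obtain ⟨x, hx⟩ := h2.exists
  obtain ⟨k, hk⟩ := Set.mem_iUnion.1 ((iUnion_spanningSets μ).symm ▸ Set.mem_univ x)
  have h3 : Set.range (fun n => b n x) ⊆ {0} := by
    rintro _ ⟨n, rfl⟩
    exact hx n k hk
  have h4 := (hbasis x).dense_span
  rw [Submodule.span_eq_bot.2 fun y hy => h3 hy] at h4
  obtain ⟨y, hy⟩ := exists_ne (0 : E.fiber x)
  have h5 := h4 y
  rw [Submodule.bot_coe, closure_singleton] at h5
  exact hy h5

end L2Sections

end L2Sections

/-! ### Push-forward of sections along translations -/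

section ScaledEmbedding

variable {P : Type*} [MeasurableSpace P] {μ : Measure P} {ρ : P → P} {c : ENNReal}

lemma integral_comp_of_support {F : Type*} [NormedAddCommGroup F] [NormedSpace ℝ F]
    (hρ : MeasurableEmbedding ρ) (hμ : μ.map ρ = c • μ.restrict (Set.range ρ)) {φ : P → F}
    (hφ : ∀ y ∉ Set.range ρ, φ y = 0) : ∫ x, φ (ρ x) ∂μ = c.toReal • ∫ y, φ y ∂μ := by
  rw [← hρ.integral_map, hμ, integral_smul_measure,
    setIntegral_eq_integral_of_forall_compl_eq_zero hφ]

lemma integrable_comp (hρ : MeasurableEmbedding ρ) (hμ : μ.map ρ = c • μ.restrict (Set.range ρ))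
    (hc : c ≠ ⊤) {φ : P → ℝ} (h : Integrable φ μ) : Integrable (fun x => φ (ρ x)) μ := by
  refine hρ.integrable_map_iff.1 ?_
  rw [hμ]
  exact h.restrict.smul_measure hc

lemma integrable_of_comp (hρ : MeasurableEmbedding ρ)
    (hμ : μ.map ρ = c • μ.restrict (Set.range ρ)) (hc : c ≠ 0) (hc' : c ≠ ⊤) {φ : P → ℝ}
    (hφ : ∀ y ∉ Set.range ρ, φ y = 0) (h : Integrable (fun x => φ (ρ x)) μ) : Integrable φ μ := by
  have h1 := hρ.integrable_map_iff.2 h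
  rw [hμ, integrable_smul_measure hc hc'] at h1
  refine (integrableOn_iff_integrable_of_support_subset fun y hy => ?_).1 h1
  by_contra hy'
  exact hy (hφ y hy')

end ScaledEmbedding

open L2Sections

section Push

variable {P : Type v} [Mul P] {E : ProductSystemData.{u} P}

open Classical in
/-- The push-forward of a section along a map `ρ` of the base that is covered by linear maps of the
fibres, extended by zero off the range of `ρ`. -/
noncomputable def pushSection (ρ : P → P) (T : ∀ x, E.fiber x →L[ℂ] E.fiber (ρ x))
    (f : ∀ x, E.fiber x) : ∀ y, E.fiber y := fun y =>
  if h : ∃ x, ρ x = y then h.choose_spec ▸ T h.choose (f h.choose) else 0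

lemma pushSection_apply {ρ : P → P} (hρ : Function.Injective ρ)
    (T : ∀ x, E.fiber x →L[ℂ] E.fiber (ρ x)) (f : ∀ x, E.fiber x) (x : P) :
    pushSection ρ T f (ρ x) = T x (f x) := by
  have h : ∃ z, ρ z = ρ x := ⟨x, rfl⟩
  have key : ∀ z (hz : ρ z = ρ x), (hz ▸ T z (f z) : E.fiber (ρ x)) = T x (f x) := by
    intro z hz
    obtain rfl := hρ hz
    rfl
  rw [pushSection, dif_pos h]
  exact key _ _

lemma pushSection_of_notMem {ρ : P → P} (T : ∀ x, E.fiber x →L[ℂ] E.fiber (ρ x))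
    (f : ∀ x, E.fiber x) {y : P} (hy : y ∉ Set.range ρ) : pushSection ρ T f y = 0 :=
  dif_neg hy

lemma pushSection_add {ρ : P → P} (hρ : Function.Injective ρ)
    (T : ∀ x, E.fiber x →L[ℂ] E.fiber (ρ x)) (f g : ∀ x, E.fiber x) :
    pushSection ρ T (f + g) = pushSection ρ T f + pushSection ρ T g := by
  funext y
  by_cases hy : y ∈ Set.range ρ
  · obtain ⟨x, rfl⟩ := hy
    simp only [Pi.add_apply, pushSection_apply hρ, map_add]
  · simp only [Pi.add_apply, pushSection_of_notMem _ _ hy, add_zero]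

lemma pushSection_smul {ρ : P → P} (hρ : Function.Injective ρ)
    (T : ∀ x, E.fiber x →L[ℂ] E.fiber (ρ x)) (c : ℂ) (f : ∀ x, E.fiber x) :
    pushSection ρ T (c • f) = c • pushSection ρ T f := by
  funext y
  by_cases hy : y ∈ Set.range ρ
  · obtain ⟨x, rfl⟩ := hy
    simp only [Pi.smul_apply, pushSection_apply hρ, map_smul]
  · simp only [Pi.smul_apply, pushSection_of_notMem _ _ hy, smul_zero]

variable [MeasurableSpace P]

lemma pushSection_mem (hE : E.IsMeasurableField) {ρ : P → P} (hρ : MeasurableEmbedding ρ)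
    {T : ∀ x, E.fiber x →L[ℂ] E.fiber (ρ x)} {f : ∀ x, E.fiber x}
    (h : ∀ t ∈ E.sections, Measurable fun x => ⟪t (ρ x), T x (f x)⟫_ℂ) :
    pushSection ρ T f ∈ E.sections := by
  refine hE.mem_of_measurable_inner _ fun t ht => ?_
  have h1 : (fun y => ⟪t y, pushSection ρ T f y⟫_ℂ) =
      Function.extend ρ (fun x => ⟪t (ρ x), T x (f x)⟫_ℂ) 0 := by
    funext y
    by_cases hy : y ∈ Set.range ρ
    · obtain ⟨x, rfl⟩ := hy
      rw [hρ.injective.extend_apply, pushSection_apply hρ.injective]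
    · rw [Function.extend_apply' _ _ _ hy, pushSection_of_notMem _ _ hy, inner_zero_right]
      rfl
  rw [h1]
  exact hρ.measurable_extend (h t ht) measurable_zero

variable {μ : Measure P} {ρ : P → P} {c : ENNReal}

/-- The push-forward of square-integrable sections. -/
noncomputable def L2Sections.push {hE : E.IsMeasurableField} (hρ : MeasurableEmbedding ρ)
    (hμ : μ.map ρ = c • μ.restrict (Set.range ρ)) (hc : c ≠ 0) (hc' : c ≠ ⊤)
    (T : ∀ x, E.fiber x →L[ℂ] E.fiber (ρ x)) {k : ℝ} (hk : ∀ x v, ‖T x v‖ = k * ‖v‖)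
    (hT : ∀ f ∈ E.sections, ∀ t ∈ E.sections, Measurable fun x => ⟪t (ρ x), T x (f x)⟫_ℂ) :
    L2Sections hE μ →ₗ[ℂ] L2Sections hE μ where
  toFun f := L2Sections.mk (pushSection ρ T (toSection f))
    (pushSection_mem hE hρ (hT _ f.mem_sections)) <| by
      refine integrable_of_comp hρ hμ hc hc' (fun y hy => ?_) ?_
      · simp [pushSection_of_notMem _ _ hy]
      · simp only [pushSection_apply hρ.injective, hk, mul_pow]
        exact f.integrable.const_mul _
  map_add' f g := L2Sections.ext fun x =>
    congrFun (pushSection_add hρ.injective T (toSection f) (toSection g)) x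
  map_smul' z f := L2Sections.ext fun x =>
    congrFun (pushSection_smul hρ.injective T z (toSection f)) x

lemma L2Sections.toSection_push {hE : E.IsMeasurableField} (hρ : MeasurableEmbedding ρ)
    (hμ : μ.map ρ = c • μ.restrict (Set.range ρ)) (hc : c ≠ 0) (hc' : c ≠ ⊤)
    (T : ∀ x, E.fiber x →L[ℂ] E.fiber (ρ x)) {k : ℝ} (hk : ∀ x v, ‖T x v‖ = k * ‖v‖)
    (hT : ∀ f ∈ E.sections, ∀ t ∈ E.sections, Measurable fun x => ⟪t (ρ x), T x (f x)⟫_ℂ)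
    (f : L2Sections hE μ) :
    toSection (L2Sections.push hρ hμ hc hc' T hk hT f) = pushSection ρ T (toSection f) := rfl

end Push

/-! ### The left regular representation -/

namespace ProductSystemData.IsProductSystem

variable {P : Type v} [Mul P] [MeasurableSpace P] [MeasurableSingletonClass P]
  {E : ProductSystemData.{u} P}

lemma measurable_inner_mulLeft (hE : E.IsProductSystem) {s : P} (a : E.fiber s)
    {f t : ∀ x, E.fiber x} (hf : f ∈ E.sections) (ht : t ∈ E.sections) :
    Measurable fun y => ⟪t (s * y), hE.isAlgebraic.mulLeft y a (f y)⟫_ℂ := by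
  classical
  have h := (hE.measurable_mul _ (hE.isMeasurableField.single_mem a) f hf t ht).comp
    (measurable_prodMk_left (x := s))
  simp only [Function.comp_def, Pi.single_eq_same] at h
  exact h

lemma measurable_inner_mulRight (hE : E.IsProductSystem) {s : P} (a : E.fiber s)
    {f t : ∀ x, E.fiber x} (hf : f ∈ E.sections) (ht : t ∈ E.sections) :
    Measurable fun y => ⟪t (y * s), hE.isAlgebraic.mulRight y a (f y)⟫_ℂ := by
  classical
  have h := (hE.measurable_mul f hf _ (hE.isMeasurableField.single_mem a) t ht).comp
    (measurable_prodMk_right (y := s))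
  simp only [Function.comp_def, Pi.single_eq_same] at h
  exact h

end ProductSystemData.IsProductSystem

/-- Left translations of `P` are measurable embeddings that preserve `μ`. -/
structure IsLeftInvariantOn {P : Type v} [Mul P] [MeasurableSpace P] (μ : Measure P) : Prop where
  embedding : ∀ s : P, MeasurableEmbedding fun x => s * x
  map_eq : ∀ s : P, μ.map (fun x => s * x) = (1 : ENNReal) • μ.restrict (Set.range fun x => s * x)

section LeftRegular

variable {P : Type v} [Mul P] [MeasurableSpace P] [MeasurableSingletonClass P]
  {E : ProductSystemData.{u} P} {μ : Measure P}

/-- The operator `(φ(a) f)(s x) = a f(x)` on square-integrable sections, for `a ∈ E(s)`. -/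
noncomputable def leftShift (hE : E.IsProductSystem) (hμ : IsLeftInvariantOn μ) {s : P}
    (a : E.fiber s) :
    L2Sections hE.isMeasurableField μ →ₗ[ℂ] L2Sections hE.isMeasurableField μ :=
  L2Sections.push (hμ.embedding s) (hμ.map_eq s) one_ne_zero ENNReal.one_ne_top
    (fun x => hE.isAlgebraic.mulLeft x a) (hE.isAlgebraic.norm_mulLeft_apply a)
    fun _ hf _ ht => hE.measurable_inner_mulLeft a hf ht

variable (hE : E.IsProductSystem) (hμ : IsLeftInvariantOn μ)

lemma leftShift_apply {s : P} (a : E.fiber s) (f : L2Sections hE.isMeasurableField μ) (x : P) :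
    toSection (leftShift hE hμ a f) (s * x) = E.mul a (toSection f x) := by
  rw [leftShift, toSection_push]
  exact pushSection_apply (ρ := fun x => s * x) (hμ.embedding s).injective _ _ x

lemma leftShift_of_notMem {s : P} (a : E.fiber s) (f : L2Sections hE.isMeasurableField μ) {y : P}
    (hy : ∀ x, s * x ≠ y) : toSection (leftShift hE hμ a f) y = 0 := by
  rw [leftShift, toSection_push]
  exact pushSection_of_notMem _ _ fun ⟨x, hx⟩ => hy x hx

lemma inner_leftShift {s : P} (a : E.fiber s) (f g : L2Sections hE.isMeasurableField μ) :
    ⟪g, leftShift hE hμ a f⟫_ℂ = ∫ y, ⟪toSection g (s * y), E.mul a (toSection f y)⟫_ℂ ∂μ := by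
  have h := integral_comp_of_support (hμ.embedding s) (hμ.map_eq s)
    (φ := fun y => ⟪toSection g y, toSection (leftShift hE hμ a f) y⟫_ℂ) fun y hy => by
      rw [leftShift_of_notMem hE hμ a f fun x hx => hy ⟨x, hx⟩, inner_zero_right]
  simp only [leftShift_apply, ENNReal.toReal_one, one_smul] at h
  exact h.symm

/-- The left regular representation of a product system on square-integrable sections. -/
noncomputable def leftRegular [SFinite μ] :
    IsometricRep E (L2Sections hE.isMeasurableField μ) where
  action s :=
    { toFun := fun a => leftShift hE hμ a
      map_add' := fun a b => LinearMap.ext fun f => L2Sections.ext fun y => by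
        rw [LinearMap.add_apply, map_add, Pi.add_apply]
        by_cases hy : ∃ x, s * x = y
        · obtain ⟨x, rfl⟩ := hy
          simp only [leftShift_apply, hE.isAlgebraic.add_mul]
        · push Not at hy
          simp only [leftShift_of_notMem hE hμ _ _ hy, add_zero]
      map_smul' := fun k a => LinearMap.ext fun f => L2Sections.ext fun y => by
        rw [LinearMap.smul_apply, map_smul, Pi.smul_apply]
        by_cases hy : ∃ x, s * x = y
        · obtain ⟨x, rfl⟩ := hy
          simp only [leftShift_apply, hE.isAlgebraic.smul_mul, RingHom.id_apply]
        · push Not at hy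
          simp only [leftShift_of_notMem hE hμ _ _ hy, smul_zero] }
  inner_action {s} a b f g := by
    change ⟪leftShift hE hμ a f, leftShift hE hμ b g⟫_ℂ = _
    rw [inner_leftShift, L2Sections.inner_def, ← integral_const_mul]
    simp only [leftShift_apply, hE.isAlgebraic.inner_mul_mul]
  action_mul {x y} a b f := L2Sections.ext fun z => by
    change toSection (leftShift hE hμ (E.mul a b) f) z =
      toSection (leftShift hE hμ a (leftShift hE hμ b f)) z
    by_cases hz : ∃ w, x * y * w = z
    · obtain ⟨w, rfl⟩ := hz
      rw [leftShift_apply]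
      refine (hE.isAlgebraic.section_assoc _ |>.2 ?_).symm
      rw [leftShift_apply, leftShift_apply]
    · push Not at hz
      rw [leftShift_of_notMem hE hμ _ _ hz]
      by_cases hx : ∃ w, x * w = z
      · obtain ⟨w, rfl⟩ := hx
        rw [leftShift_apply, leftShift_of_notMem hE hμ b f fun w' hw' => hz w' ?_]
        · exact ((hE.isAlgebraic.mulLeft w a).map_zero).symm
        · rw [hE.isAlgebraic.mul_assoc, hw']
      · push Not at hx
        rw [leftShift_of_notMem hE hμ _ _ hx]
  measurable s hs f g := by
    have h := fun x => inner_leftShift hE hμ (s x) f g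
    have hm := hE.measurable_mul s hs _ f.mem_sections _ g.mem_sections
    have h1 : Measurable fun x =>
        ∫ y, ⟪toSection g (x * y), E.mul (s x) (toSection f y)⟫_ℂ ∂μ :=
      (hm.stronglyMeasurable.integral_prod_right (ν := μ)).measurable
    exact (funext h) ▸ h1

/-- Sections that vanish off `s P` are in the closed range of the action of `E(s)`. -/
lemma exists_mem_range_leftRegular [SFinite μ] {s : P} (g : L2Sections hE.isMeasurableField μ)
    (hg : ∀ y, (∀ x, s * x ≠ y) → toSection g y = 0) {ε : ℝ} (hε : 0 < ε) :
    ∃ w ∈ (leftRegular hE hμ).range s, ‖g - w‖ < ε := by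
  have _ := hE.isAlgebraic.separable
  obtain ⟨b, hb⟩ := exists_isZeroPaddedBasis_nat (K := E.fiber s)
  have hgi : Integrable (fun y => ‖toSection g (s * y)‖ ^ 2) μ :=
    integrable_comp (hμ.embedding s) (hμ.map_eq s) ENNReal.one_ne_top g.integrable
  -- the component of `g` in the direction `b n`
  let q : ℕ → ∀ y, E.fiber y := fun n y =>
    ContinuousLinearMap.adjoint (hE.isAlgebraic.mulLeft y (b n)) (toSection g (s * y))
  have hqm : ∀ n, q n ∈ E.sections := fun n => by
    refine hE.isMeasurableField.mem_of_measurable_inner _ fun t ht => ?_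
    have h := Complex.continuous_conj.measurable.comp
      (hE.measurable_inner_mulLeft (b n) ht g.mem_sections)
    convert h using 1
    funext y
    rw [ContinuousLinearMap.adjoint_inner_right, Function.comp_apply, inner_conj_symm]
  have hqi : ∀ n, Integrable (fun y => ‖q n y‖ ^ 2) μ := fun n => by
    refine hgi.mono' (hE.isMeasurableField.measurable_norm_sq (hqm n)).aestronglyMeasurable
      (Filter.Eventually.of_forall fun y => ?_)
    rw [Real.norm_of_nonneg (by positivity)]
    have h1 : ‖hE.isAlgebraic.mulLeft y (b n)‖ ≤ 1 := by
      refine ContinuousLinearMap.opNorm_le_bound _ zero_le_one fun v => ?_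
      rw [hE.isAlgebraic.mulLeft_apply, hE.isAlgebraic.norm_mul]
      gcongr
      rcases hb.eq_zero_or_norm n with h | h <;> simp [h]
    have h2 : ‖q n y‖ ≤ ‖toSection g (s * y)‖ := by
      refine ((ContinuousLinearMap.adjoint (hE.isAlgebraic.mulLeft y (b n))).le_opNorm _).trans ?_
      rw [LinearIsometryEquiv.norm_map]
      exact mul_le_of_le_one_left (norm_nonneg _) h1
    gcongr
  let w : ℕ → L2Sections hE.isMeasurableField μ := fun N =>
    ∑ n ∈ Finset.range N, leftShift hE hμ (b n) (L2Sections.mk (q n) (hqm n) (hqi n))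
  have hw : ∀ N y, toSection (w N) (s * y) = ∑ n ∈ Finset.range N, E.mul (b n) (q n y) := by
    intro N y
    simp only [w, map_sum, Finset.sum_apply, leftShift_apply, toSection_mk]
  have hw0 : ∀ N y, (∀ x, s * x ≠ y) → toSection (w N) y = 0 := by
    intro N y hy
    simp only [w, map_sum, Finset.sum_apply]
    exact Finset.sum_eq_zero fun n _ => leftShift_of_notMem hE hμ _ _ hy
  have hnorm : ∀ N, ‖g - w N‖ ^ 2 =
      ∫ y, ‖toSection g (s * y) - ∑ n ∈ Finset.range N, E.mul (b n) (q n y)‖ ^ 2 ∂μ := by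
    intro N
    have h := integral_comp_of_support (hμ.embedding s) (hμ.map_eq s)
      (φ := fun y => ‖toSection (g - w N) y‖ ^ 2) fun y hy => by
        have hy' : ∀ x, s * x ≠ y := fun x hx => hy ⟨x, hx⟩
        rw [map_sub, Pi.sub_apply, hg y hy', hw0 N y hy']
        simp
    simp only [map_sub, Pi.sub_apply, hw, ENNReal.toReal_one, one_smul] at h
    rw [h, norm_sq_eq]
    simp only [map_sub, Pi.sub_apply]
  have hlim : Filter.Tendsto (fun N => ‖g - w N‖ ^ 2) Filter.atTop (nhds 0) := by
    simp only [hnorm]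
    have h0 : ∫ _, (0 : ℝ) ∂μ = 0 := integral_zero _ _
    rw [← h0]
    refine tendsto_integral_of_dominated_convergence (fun y => ‖toSection g (s * y)‖ ^ 2)
      (fun N => ?_) hgi (fun N => Filter.Eventually.of_forall fun y => ?_)
      (Filter.Eventually.of_forall fun y => ?_)
    · have h := (hE.isMeasurableField.measurable_norm_sq (g - w N).mem_sections).comp
        (hμ.embedding s).measurable
      simp only [Function.comp_def, map_sub, Pi.sub_apply, hw] at h
      exact h.aestronglyMeasurable
    · rw [Real.norm_of_nonneg (by positivity)]
      gcongr
      exact (hE.isAlgebraic.isUnitaryAction_mulLeft s y).norm_sub_sum_le hb (Finset.range N)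
        (toSection g (s * y))
    · have h := ((hE.isAlgebraic.isUnitaryAction_mulLeft s y).hasSum_apply_adjoint hb
        (toSection g (s * y))).tendsto_sum_nat
      have h1 := ((tendsto_const_nhds (x := toSection g (s * y))).sub h).norm.pow 2
      simpa using h1
  obtain ⟨N, hN⟩ := (hlim.eventually (gt_mem_nhds (pow_pos hε 2))).exists
  refine ⟨w N, Submodule.sum_mem _ fun n _ => Submodule.subset_span ⟨b n, _, rfl⟩, ?_⟩
  exact lt_of_pow_lt_pow_left₀ 2 hε.le hN

/-! ### The commuting right shift -/

variable {a : P} {e : E.fiber a} {c : ENNReal}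

/-- The operator `f ↦ (x a ↦ f(x) e)` on square-integrable sections, where right translation by `a`
scales the measure by `c`. -/
noncomputable def rightPush (hE : E.IsProductSystem) (e : E.fiber a)
    (ha : MeasurableEmbedding fun x : P => x * a)
    (hμa : μ.map (fun x => x * a) = c • μ.restrict (Set.range fun x => x * a))
    (hc : c ≠ 0) (hc' : c ≠ ⊤) :
    L2Sections hE.isMeasurableField μ →ₗ[ℂ] L2Sections hE.isMeasurableField μ :=
  L2Sections.push ha hμa hc hc' (fun x => hE.isAlgebraic.mulRight x e)
    (fun _ v => hE.isAlgebraic.norm_mulRight_apply v e)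
    fun _ hf _ ht => hE.measurable_inner_mulRight e hf ht

lemma rightPush_apply (ha : MeasurableEmbedding fun x : P => x * a)
    (hμa : μ.map (fun x => x * a) = c • μ.restrict (Set.range fun x => x * a))
    (hc : c ≠ 0) (hc' : c ≠ ⊤) (f : L2Sections hE.isMeasurableField μ) (x : P) :
    toSection (rightPush hE e ha hμa hc hc' f) (x * a) = E.mul (toSection f x) e := by
  rw [rightPush, toSection_push]
  exact pushSection_apply (ρ := fun x => x * a) ha.injective _ _ x

lemma rightPush_of_notMem (ha : MeasurableEmbedding fun x : P => x * a)
    (hμa : μ.map (fun x => x * a) = c • μ.restrict (Set.range fun x => x * a))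
    (hc : c ≠ 0) (hc' : c ≠ ⊤) (f : L2Sections hE.isMeasurableField μ) {y : P}
    (hy : ∀ x, x * a ≠ y) : toSection (rightPush hE e ha hμa hc hc' f) y = 0 := by
  rw [rightPush, toSection_push]
  exact pushSection_of_notMem _ _ fun ⟨x, hx⟩ => hy x hx

/-- Right multiplication by a unit vector, `(R f)(x a) = √c f(x) e`. The factor makes `R` an
isometry. -/
noncomputable def rightShift (hE : E.IsProductSystem) (he : ‖e‖ = 1)
    (ha : MeasurableEmbedding fun x : P => x * a)
    (hμa : μ.map (fun x => x * a) = c • μ.restrict (Set.range fun x => x * a))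
    (hc : c ≠ 0) (hc' : c ≠ ⊤) :
    L2Sections hE.isMeasurableField μ →ₗᵢ[ℂ] L2Sections hE.isMeasurableField μ where
  toLinearMap := ((Real.sqrt c.toReal : ℝ) : ℂ) • rightPush hE e ha hμa hc hc'
  norm_map' f := by
    have h := integral_comp_of_support ha hμa
      (φ := fun y => ‖toSection (rightPush hE e ha hμa hc hc' f) y‖ ^ 2) fun y hy => by
        rw [rightPush_of_notMem hE ha hμa hc hc' f fun x hx => hy ⟨x, hx⟩]
        simp
    simp only [rightPush_apply, hE.isAlgebraic.norm_mul, he, mul_one] at h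
    rw [← norm_sq_eq, ← norm_sq_eq] at h
    refine (sq_eq_sq₀ (norm_nonneg _) (norm_nonneg _)).1 ?_
    rw [LinearMap.smul_apply, norm_smul, mul_pow, Complex.norm_real,
      Real.norm_of_nonneg (Real.sqrt_nonneg _), Real.sq_sqrt ENNReal.toReal_nonneg, h, smul_eq_mul]

variable (he : ‖e‖ = 1) (ha : MeasurableEmbedding fun x : P => x * a)
    (hμa : μ.map (fun x => x * a) = c • μ.restrict (Set.range fun x => x * a))
    (hc : c ≠ 0) (hc' : c ≠ ⊤)

lemma toSection_rightShift (f : L2Sections hE.isMeasurableField μ) (y : P) :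
    toSection (rightShift hE he ha hμa hc hc' f) y =
      ((Real.sqrt c.toReal : ℝ) : ℂ) • toSection (rightPush hE e ha hμa hc hc' f) y := rfl

lemma rightShift_apply (f : L2Sections hE.isMeasurableField μ) (x : P) :
    toSection (rightShift hE he ha hμa hc hc' f) (x * a) =
      ((Real.sqrt c.toReal : ℝ) : ℂ) • E.mul (toSection f x) e := by
  rw [toSection_rightShift, rightPush_apply]

lemma rightShift_of_notMem (f : L2Sections hE.isMeasurableField μ) {y : P}
    (hy : ∀ x, x * a ≠ y) : toSection (rightShift hE he ha hμa hc hc' f) y = 0 := by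
  rw [toSection_rightShift, rightPush_of_notMem hE ha hμa hc hc' f hy, smul_zero]

lemma rightShift_leftShift {s : P} (b : E.fiber s) (f : L2Sections hE.isMeasurableField μ) :
    rightShift hE he ha hμa hc hc' (leftShift hE hμ b f) =
      leftShift hE hμ b (rightShift hE he ha hμa hc hc' f) := by
  refine L2Sections.ext fun z => ?_
  by_cases hz : ∃ w, s * w * a = z
  · obtain ⟨w, rfl⟩ := hz
    rw [rightShift_apply, leftShift_apply, ← hE.isAlgebraic.mul_smul]
    refine (hE.isAlgebraic.section_assoc _ |>.2 ?_).symm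
    rw [leftShift_apply, rightShift_apply]
    simp only [hE.isAlgebraic.mul_smul]
  · push Not at hz
    trans 0
    · by_cases hx : ∃ w, w * a = z
      · obtain ⟨w, rfl⟩ := hx
        rw [rightShift_apply, leftShift_of_notMem hE hμ b f fun w' hw' => hz w' (by rw [hw'])]
        rw [← hE.isAlgebraic.mulRight_apply, map_zero, smul_zero]
      · push Not at hx
        exact rightShift_of_notMem _ _ _ _ _ _ _ hx
    · by_cases hx : ∃ w, s * w = z
      · obtain ⟨w, rfl⟩ := hx
        rw [leftShift_apply, rightShift_of_notMem _ _ _ _ _ _ _ fun w' hw' => hz w' ?_,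
          ← hE.isAlgebraic.mulLeft_apply, map_zero]
        rw [hE.isAlgebraic.mul_assoc, hw']
      · push Not at hx
        rw [leftShift_of_notMem hE hμ _ _ hx]

lemma rightShift_pow_eq_zero (k : ℕ) (f : L2Sections hE.isMeasurableField μ) {y : P}
    (hy : ∀ x, (fun x => x * a)^[k] x = y → toSection f x = 0) :
    toSection (((rightShift hE he ha hμa hc hc').toLinearMap ^ k) f) y = 0 := by
  induction k generalizing f with
  | zero => exact hy y rfl
  | succ k ih =>
    rw [pow_succ, Module.End.mul_apply]
    refine ih _ fun x hx => ?_
    change toSection (rightShift hE he ha hμa hc hc' f) x = 0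
    by_cases hw : ∃ w, w * a = x
    · obtain ⟨w, rfl⟩ := hw
      rw [rightShift_apply, hy w hx, ← hE.isAlgebraic.mulRight_apply, map_zero, smul_zero]
    · push Not at hw
      exact rightShift_of_notMem _ _ _ _ _ _ _ hw

lemma norm_linearIsometry_pow {V : Type*} [SeminormedAddCommGroup V] [NormedSpace ℂ V]
    (R : V →ₗᵢ[ℂ] V) (k : ℕ) (v : V) : ‖(R.toLinearMap ^ k) v‖ = ‖v‖ := by
  induction k generalizing v with
  | zero => rfl
  | succ k ih =>
    rw [pow_succ, Module.End.mul_apply, ih]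
    exact R.norm_map v

/-- If the powers of `a` eventually push every point into `s P`, then the powers of the right shift
push every section approximately into the range of the action of `E(s)`. -/
lemma exists_rightShift_pow_near [SFinite μ] {s : P}
    (hs : ∀ y : P, ∃ k, ∃ z, s * z = (fun x => x * a)^[k] y)
    (f : L2Sections hE.isMeasurableField μ) {ε : ℝ} (hε : 0 < ε) :
    ∃ k, ∃ w ∈ (leftRegular hE hμ).range s,
      ‖((rightShift hE he ha hμa hc hc').toLinearMap ^ k) f - w‖ < ε := by
  let A : ℕ → Set P := fun k => (fun x => x * a)^[k] ⁻¹' Set.range fun x => s * x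
  have hA : ∀ k, MeasurableSet (A k) := fun k =>
    (ha.measurable.iterate k) (hμ.embedding s).measurableSet_range
  have hmono : Monotone A := by
    refine monotone_nat_of_le_succ fun k y hy => ?_
    obtain ⟨z, hz⟩ := hy
    refine ⟨z * a, ?_⟩
    rw [Function.iterate_succ_apply', ← hz, hE.isAlgebraic.mul_assoc]
  obtain ⟨k, hk⟩ := f.exists_norm_sub_restrict_lt hA hmono hs (half_pos hε)
  set R := (rightShift hE he ha hμa hc hc').toLinearMap
  obtain ⟨w, hw, hlt⟩ := exists_mem_range_leftRegular hE hμ (s := s) ((R ^ k) (f.restrict (hA k)))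
    (fun y hy => rightShift_pow_eq_zero hE he ha hμa hc hc' k _ fun x hx => by
      refine f.restrict_apply_of_notMem (hA k) ?_
      rintro ⟨z, hz⟩
      exact hy z (hz.trans hx)) (half_pos hε)
  refine ⟨k, w, hw, ?_⟩
  calc _ ≤ ‖(R ^ k) f - (R ^ k) (f.restrict (hA k))‖ + ‖(R ^ k) (f.restrict (hA k)) - w‖ :=
        norm_sub_le_norm_sub_add_norm_sub _ _ _
    _ < ε / 2 + ε / 2 := by
        rw [← map_sub, norm_linearIsometry_pow]
        exact add_lt_add hk hlt
    _ = ε := add_halves ε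

end LeftRegular

/-! ### Interior points of a normal subsemigroup -/

namespace Subsemigroup

section Group

variable {G : Type v} [Group G] {P : Subsemigroup G}

lemma IsNormalIn.conj_mem (hP : P.IsNormalIn) (g : G) {x : G} (hx : x ∈ P) :
    g * x * g⁻¹ ∈ P := by
  have h : g * x * g⁻¹ ∈ (fun x : G => g * x * g⁻¹) '' (P : Set G) := ⟨x, hx, rfl⟩
  rwa [hP g] at h

/-- The `x` with `x aⁿ ∈ P` for some `n ≥ 1` form a semigroup, as `P` is normal. This subgroup consists
of the `x` that belong to it together with their inverses. -/
def IsNormalIn.absorbed (hP : P.IsNormalIn) {a : G} (ha : a ∈ P) : Subgroup G where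
  carrier := {x | (∃ n : ℕ, 1 ≤ n ∧ x * a ^ n ∈ P) ∧ ∃ n : ℕ, 1 ≤ n ∧ x⁻¹ * a ^ n ∈ P}
  one_mem' := ⟨⟨1, le_rfl, by simpa⟩, ⟨1, le_rfl, by simpa⟩⟩
  mul_mem' := by
    have key : ∀ x y : G, (∃ n : ℕ, 1 ≤ n ∧ x * a ^ n ∈ P) → (∃ n : ℕ, 1 ≤ n ∧ y * a ^ n ∈ P) →
        ∃ n : ℕ, 1 ≤ n ∧ x * y * a ^ n ∈ P := by
      rintro x y ⟨n, hn, hx⟩ ⟨m, hm, hy⟩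
      refine ⟨m + n, by omega, ?_⟩
      have h := P.mul_mem hx (hP.conj_mem (a ^ n)⁻¹ hy)
      convert h using 1
      rw [pow_add]
      group
    rintro x y ⟨hx, hx'⟩ ⟨hy, hy'⟩
    refine ⟨key x y hx hy, ?_⟩
    rw [mul_inv_rev]
    exact key _ _ hy' hx'
  inv_mem' := by
    rintro x ⟨hx, hx'⟩
    exact ⟨hx', by rwa [inv_inv]⟩

end Group

variable {G : Type v} [Group G] [TopologicalSpace G] [IsTopologicalGroup G] {P : Subsemigroup G}

lemma IsNormalIn.exists_mul_pow_mem [ConnectedSpace G] (hP : P.IsNormalIn) {a : G}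
    (ha : a ∈ interior (P : Set G)) (x : G) : ∃ n : ℕ, 1 ≤ n ∧ x * a ^ n ∈ P := by
  set U := hP.absorbed (interior_subset ha)
  have h1 : ∀ᶠ x in nhds (1 : G), x * a ∈ P := by
    have hc : Filter.Tendsto (fun x : G => x * a) (nhds 1) (nhds a) := by
      simpa using (continuous_mul_const a).tendsto 1
    exact hc (mem_interior_iff_mem_nhds.1 ha)
  have h2 : ∀ᶠ x in nhds (1 : G), x⁻¹ * a ∈ P := by
    have hc : Filter.Tendsto (fun x : G => x⁻¹) (nhds 1) (nhds 1) := by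
      simpa using (continuous_inv (G := G)).tendsto 1
    exact hc.eventually h1
  have hU : IsOpen (U : Set G) := by
    refine U.isOpen_of_mem_nhds (g := 1) ?_
    filter_upwards [h1, h2] with x hx hx'
    exact ⟨⟨1, le_rfl, by simpa⟩, ⟨1, le_rfl, by simpa⟩⟩
  have huniv := IsClopen.eq_univ ⟨U.isClosed_of_isOpen hU, hU⟩ ⟨1, U.one_mem⟩
  exact (huniv.symm ▸ Set.mem_univ x : x ∈ (U : Set G)).1

lemma IsNormalIn.isOrderUnit [ConnectedSpace G] (hP : P.IsNormalIn) {a : G}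
    (ha : a ∈ interior (P : Set G)) : P.IsOrderUnit a := by
  refine ⟨interior_subset ha, fun x _ => ?_⟩
  obtain ⟨n, hn, h⟩ := hP.exists_mul_pow_mem ha x⁻¹
  exact ⟨n, hn, _, h, by group⟩

end Subsemigroup

/-! ### Haar measure on a subsemigroup -/

section HaarSubsemigroup

variable {G : Type v} [MeasurableSpace G] {S : Set G} {ψ : G → G} {ρ : S → S}

lemma measurableEmbedding_of_coe (hS : MeasurableSet S) (hψ : MeasurableEmbedding ψ)
    (h : ∀ x, (ρ x : G) = ψ x) : MeasurableEmbedding ρ where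
  injective x y hxy := by
    have h1 : ψ x = ψ y := by rw [← h, ← h, hxy]
    exact Subtype.ext (hψ.injective h1)
  measurable := by
    refine Measurable.subtype_mk (f := fun x : S => (ρ x : G)) ?_ (h := fun x => (ρ x).2)
    simp only [h]
    exact hψ.measurable.comp measurable_subtype_coe
  measurableSet_image' A hA := by
    refine (MeasurableEmbedding.subtype_coe hS).measurableSet_image.1 ?_
    have h1 : ((↑) : S → G) '' (ρ '' A) = ψ '' ((↑) '' A) := by
      simp only [Set.image_image, h]
    rw [h1]
    exact hψ.measurableSet_image.2 ((MeasurableEmbedding.subtype_coe hS).measurableSet_image.2 hA)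

lemma map_comap_coe {ν : Measure G} {c : ENNReal} (hS : MeasurableSet S)
    (hψ : MeasurableEmbedding ψ) (hν : ν.map ψ = c • ν) (h : ∀ x, (ρ x : G) = ψ x) :
    (ν.comap ((↑) : S → G)).map ρ = c • (ν.comap ((↑) : S → G)).restrict (Set.range ρ) := by
  have hρ := measurableEmbedding_of_coe hS hψ h
  ext t ht
  rw [hρ.map_apply, Measure.smul_apply, Measure.restrict_apply ht, comap_subtype_coe_apply hS,
    comap_subtype_coe_apply hS]
  have h1 : ((↑) : S → G) '' (t ∩ Set.range ρ) = ψ '' ((↑) '' (ρ ⁻¹' t)) := by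
    rw [← Set.image_preimage_eq_inter_range]
    simp only [Set.image_image, h]
  rw [h1, ← Measure.smul_apply, ← hν, hψ.map_apply, Set.preimage_image_eq _ hψ.injective]

end HaarSubsemigroup

theorem mainTheorem11 {G : Type v} [Group G] [TopologicalSpace G] [IsTopologicalGroup G]
    [LocallyCompactSpace G] [SecondCountableTopology G] [T2Space G] [ConnectedSpace G]
    [MeasurableSpace G] [BorelSpace G]
    (P : Subsemigroup G) (hP : MeasurableSet (P : Set G))
    (hint : (interior (P : Set G)).Nonempty) (hnormal : P.IsNormalIn) :
    (∀ a ∈ interior (P : Set G), P.IsOrderUnit a) ∧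
    ∀ E : ProductSystemData.{u} P, E.IsProductSystem → E.IsConcrete := by
  refine ⟨fun a ha => hnormal.isOrderUnit ha, fun E hE => ?_⟩
  obtain ⟨a, ha⟩ := hint
  let ν : Measure G := Measure.haar
  let μ : Measure P := ν.comap ((↑) : P → G)
  have hmap : μ.map ((↑) : P → G) = ν.restrict P := map_comap_subtype_coe hP ν
  have _ : SigmaFinite μ := by
    refine SigmaFinite.of_map μ measurable_subtype_coe.aemeasurable ?_
    rw [hmap]
    infer_instance
  have hμ0 : μ ≠ 0 := by
    intro h0
    rw [h0, Measure.map_zero, eq_comm, Measure.restrict_eq_zero] at hmap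
    exact (isOpen_interior.measure_pos ν ⟨a, ha⟩).ne'
      (measure_mono_null interior_subset hmap)
  have hleft : IsLeftInvariantOn μ :=
    ⟨fun s => measurableEmbedding_of_coe hP (measurableEmbedding_mulLeft (s : G)) fun x => rfl,
      fun s => map_comap_coe hP (measurableEmbedding_mulLeft (s : G))
        (by rw [one_smul]; exact map_mul_left_eq_self ν (s : G)) fun x => rfl⟩
  let a' : P := ⟨a, interior_subset ha⟩
  have hra : MeasurableEmbedding fun x : P => x * a' :=
    measurableEmbedding_of_coe hP (measurableEmbedding_mulRight a) fun x => rfl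
  let c : ENNReal := (Measure.modularCharacterFun a : ENNReal)
  have hc : c ≠ 0 := by
    exact ENNReal.coe_ne_zero.2 (Measure.modularCharacterFun_pos a).ne'
  have hμa : μ.map (fun x => x * a') = c • μ.restrict (Set.range fun x => x * a') :=
    map_comap_coe hP (measurableEmbedding_mulRight a)
      (Measure.map_right_mul_eq_modularCharacterFun_smul ν a) fun x => rfl
  have _ := hE.isAlgebraic.nontrivial
  obtain ⟨e, he⟩ := exists_norm_eq (E.fiber a') zero_le_one
  -- `s P` absorbs the orbits of right translation by `a`, since `a` is an order unit
  have hs : ∀ s y : P, ∃ k, ∃ z, s * z = (fun x => x * a')^[k] y := by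
    intro s y
    obtain ⟨n, _, hn⟩ := hnormal.exists_mul_pow_mem ha ((s : G)⁻¹ * y)
    refine ⟨n, ⟨_, hn⟩, Subtype.ext ?_⟩
    have h : ∀ k, (((fun x => x * a')^[k] y : P) : G) = y * a ^ k := fun k => by
      induction k with
      | zero => simp
      | succ k ih => rw [Function.iterate_succ_apply', MulMemClass.coe_mul, ih, pow_succ, mul_assoc]
    rw [h, MulMemClass.coe_mul]
    group
  let R := rightShift hE he hra hμa hc ENNReal.coe_ne_top
  have hR : ∀ (x : P) (b : E.fiber x) f, R ((leftRegular hE hleft).action x b f) =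
      (leftRegular hE hleft).action x b (R f) := fun x b f =>
    rightShift_leftShift hE hleft he hra hμa hc ENNReal.coe_ne_top b f
  let π := ((leftRegular hE hleft).stableSeq R hR).completion
    ((leftRegular hE hleft).dense_range_stableSeq R hR fun s f ε hε =>
      exists_rightShift_pow_near hE hleft he hra hμa hc ENNReal.coe_ne_top (hs s) f hε)
  have _ : Nontrivial (UniformSpace.Completion (StableSeq R)) := by
    obtain ⟨f, hf⟩ := L2Sections.exists_norm_ne_zero (hE := hE.isMeasurableField) hμ0
      hE.isAlgebraic.nontrivial
    refine ⟨(StableSeq.embed R 0 f : StableSeq R), 0, fun h => hf ?_⟩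
    rw [← StableSeq.norm_embed (R := R) 0 f, ← UniformSpace.Completion.norm_coe, h, norm_zero]
  exact π.isConcrete hE
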